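/- Let $1\le p\le q\le n-1$ and $d$ be integers, let $U$ be an open subset of $\mathbb C^n$, and let $\mathcal F_1,\dots,\mathcal F_d$ be holomorphic foliations of codimension $q$ on $U$, with tangent bundles $T\mathcal F_i$ (a holomorphic $d$-web of codimension $q$; general position of the $\mathcal F_i$ is allowed but need not be assumed). **Notation.** Let $c(r,h)=\binom{r-1+h}{h}$ for $h\ge0$, $c(r,h)=0$ for $h<0$, and $$z(n,p,k)=\sum_{j=p}^{n}(-1)^{p-j}\binom nj\,c(n,k+p-j).$$ A holomorphic $p$-form $\omega$ is *$\mathcal F_i$-basic* if $i_X\omega=0$ and $L_X\omega=0$ for all vector fields $X$ tangent to $\mathcal F_i$. A *closed $p$-abelian relation* is a family $(\omega_i)_{1\le i\le d}$ of closed $\mathcal F_i$-basic holomorphic $p$-forms $\omega_i$ with $\sum_i\omega_i=0$. The *closed $p$-rank* $\widetilde r_p$ is the supremum over $m\in U$ of the dimension of the space of germs at $m$ of closed $p$-abelian relations. A *closed formal $p$-abelian relation of order $k$ at $m\in U$* is a family $(a_i)_{1\le i\le d}$, where $a_i$ is the $k$-jet at $m$ of a closed $\mathcal F_i$-basic holomorphic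 $p$-form defined near $m$, such that $\sum_i a_i=0$. These families form a vector space $\widetilde R^p_{k,m}\subset\bigoplus_{i=1}^d J^k(\Lambda^pT^*U)_m$. For $m\in U$ and a subspace $S\subset T_mU$, with $N=T_mU/S$, let $Z_k(S)$ be the kernel of the Koszul differential $S^kN^*\otimes\Lambda^pN^*\to S^{k-1}N^*\otimes\Lambda^{p+1}N^*$ (for $k=0$, $Z_0(S)=\Lambda^pN^*$), viewed inside $S^kT^*_mU\otimes\Lambda^pT_m^*U$. The web is *strongly $p$-ordinary* if, for every $m\in U$ and every $k\ge0$, the linear map $$\widetilde P_k:\ \bigoplus_{i=1}^d Z_k(T_m\mathcal F_i)\to Z_k(0),\qquad (w_i)_i\mapsto\sum_i w_i,$$ has the maximal rank $\min\bigl(z(n,p,k),\,d\,z(q,p,k)\bigr)$. **Theorem.** Suppose that the web is strongly $p$-ordinary and that $d>z(n,p,0)/z(q,p,0)$. Then there is a greatest integer $h\ge0$ with $z(n,p,h)/z(q,p,h)\le d$; call it $k_p^1$. (i) For every $k\le k^1_p$, the spaces $\widetilde R^p_{k,m}$, $m\in U$, form a holomorphic vector bundle $\widetilde R^p_k$ on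 $U$ (a holomorphic subbundle of $\bigoplus_{i=1}^d J^k(\Lambda^pT^*U)$) of rank $$\sum_{h=0}^k z(q,p,h)\Bigl(d-\frac{z(n,p,h)}{z(q,p,h)}\Bigr).$$ (ii) The closed $p$-rank is finite and $$\widetilde r_p\le \pi'_p(n,d,q):=\sum_{h\ge0}z(q,p,h)\Bigl(d-\frac{z(n,p,h)}{z(q,p,h)}\Bigr)^+,$$ where $a^+=\max(a,0)$ and only finitely many terms of the sum are nonzero. -/

import Mathlib

open Filter Topology

noncomputable section

namespace Web

/-- `c(r,h)`, the dimension of the space of homogeneous polynomials of degree `h` in `r`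
variables, i.e. the binomial coefficient of `r - 1 + h` over `h`. -/
def c (r h : ℕ) : ℕ := Nat.multichoose r h

/-- `z(n,p,k) = ∑_{j=p}^{n} (-1)^(p-j) b(n,j) c(n,k+p-j)`, where `c(n,m) = 0` for `m < 0`. -/
def z (n p k : ℕ) : ℤ :=
  ∑ j ∈ (Finset.Icc p n).filter (fun j => j ≤ k + p),
    (-1) ^ (j - p) * (n.choose j : ℤ) * (c n (k + p - j) : ℤ)

/-- The quotient `z(n,p,h) / z(q,p,h)`. -/
def ratio (n q p h : ℕ) : ℝ := (z n p h : ℝ) / (z q p h : ℝ)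

/-- The greatest integer `h ≥ 0` such that `z(n,p,h) / z(q,p,h) ≤ d`. -/
def kOne (n d q p : ℕ) : ℕ := sSup {h : ℕ | ratio n q p h ≤ (d : ℝ)}

/-- The general term `z(q,p,h) (d - z(n,p,h)/z(q,p,h))^+` of `π'_p(n,d,q)`. -/
def piTerm (n d q p h : ℕ) : ℝ := (z q p h : ℝ) * max ((d : ℝ) - ratio n q p h) 0

/-- `π'_p(n,d,q) = ∑_{h ≥ 0} z(q,p,h) (d - z(n,p,h)/z(q,p,h))^+`. -/
def piPrime (n d q p : ℕ) : ℝ := ∑' h : ℕ, piTerm n d q p h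

/-- The ambient space `ℂⁿ`. -/
abbrev Amb (n : ℕ) : Type := Fin n → ℂ

/-- The exterior power `Λ^p (ℂⁿ)^*`. -/
abbrev Alt (n p : ℕ) : Type := Amb n [⋀^Fin p]→L[ℂ] ℂ

/-- A holomorphic foliation of codimension `q` on `U ⊆ ℂⁿ`: a field `T` of subspaces (the tangent
bundle of the foliation) which near every point of `U` is the kernel of the differential of a
holomorphic submersion to `ℂ^q`. Values of `T` outside `U` are irrelevant. -/
structure Foliation (n q : ℕ) (U : Set (Amb n)) where
  T : Amb n → Submodule ℂ (Amb n)
  exists_submersion : ∀ x ∈ U, ∃ W : Set (Amb n), IsOpen W ∧ x ∈ W ∧ W ⊆ U ∧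
    ∃ u : Amb n → (Fin q → ℂ), AnalyticOnNhd ℂ u W ∧
      ∀ y ∈ W, Function.Surjective (fderiv ℂ u y) ∧
        T y = LinearMap.ker (fderiv ℂ u y : Amb n →ₗ[ℂ] (Fin q → ℂ))

variable {n : ℕ}

/-- `ω` is semi-basic at `y`: `i_X ω = 0` at `y` for all `X` tangent to the foliation. -/
def SemiBasicAt {p : ℕ} (T : Amb n → Submodule ℂ (Amb n)) (ω : Amb n → Alt n p) (y : Amb n) : Prop :=
  ∀ v : Fin p → Amb n, (∃ j, v j ∈ T y) → ω y v = 0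

/-- `i_X dω = 0` at `y` for all `X` tangent to the foliation. For a semi-basic form this is
invariance, since then `L_X ω = i_X dω + d (i_X ω) = i_X dω`. -/
def InvariantAt {p : ℕ} (T : Amb n → Submodule ℂ (Amb n)) (ω : Amb n → Alt n p) (y : Amb n) : Prop :=
  ∀ v : Fin (p + 1) → Amb n, (∃ j, v j ∈ T y) → extDeriv ω y v = 0

/-- The `p`-forms which, near `m`, are holomorphic, basic (semi-basic and invariant) for the
foliation tangent to `T`, and closed. -/
def closedBasic (p : ℕ) (T : Amb n → Submodule ℂ (Amb n)) (m : Amb n) :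
    Submodule ℂ (Amb n → Alt n p) where
  carrier := {ω | AnalyticAt ℂ ω m ∧
    ∀ᶠ y in 𝓝 m, SemiBasicAt T ω y ∧ InvariantAt T ω y ∧ extDeriv ω y = 0}
  zero_mem' := by
    have h : ∀ y : Amb n, extDeriv (0 : Amb n → Alt n p) y = 0 := fun y => by
      simpa using extDeriv_smul (x := y) (0 : ℂ) (0 : Amb n → Alt n p)
    refine ⟨analyticAt_const, Eventually.of_forall fun y => ⟨fun v _ => ?_, fun v _ => ?_, h y⟩⟩
    · simp
    · rw [h y]; simp
  add_mem' := by
    rintro a b ⟨ha, ha'⟩ ⟨hb, hb'⟩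
    refine ⟨ha.add hb, ?_⟩
    filter_upwards [ha', hb', ha.eventually_analyticAt, hb.eventually_analyticAt]
      with y h1 h2 h3 h4
    have h : extDeriv (a + b) y = extDeriv a y + extDeriv b y :=
      extDeriv_add h3.differentiableAt h4.differentiableAt
    refine ⟨fun v hv => ?_, fun v hv => ?_, ?_⟩
    · have e1 := h1.1 v hv
      have e2 := h2.1 v hv
      simp [e1, e2]
    · have e1 := h1.2.1 v hv
      have e2 := h2.2.1 v hv
      rw [h]; simp [e1, e2]
    · rw [h, h1.2.2, h2.2.2, add_zero]
  smul_mem' := by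
    rintro t a ⟨ha, ha'⟩
    refine ⟨analyticAt_const.smul ha, ?_⟩
    filter_upwards [ha', ha.eventually_analyticAt] with y h1 h3
    have h : extDeriv (t • a) y = t • extDeriv a y := extDeriv_smul t a
    refine ⟨fun v hv => ?_, fun v hv => ?_, ?_⟩
    · have e1 := h1.1 v hv
      simp [e1]
    · have e1 := h1.2.1 v hv
      rw [h]; simp [e1]
    · rw [h, h1.2.2, smul_zero]

/-- The fibre `J^k(Λ^p T^*ℂⁿ)` of the bundle of `k`-jets of `p`-forms in the coordinates of `ℂⁿ`:
the derivatives of orders `0, …, k` at a point. -/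
abbrev Jet (n p k : ℕ) : Type :=
  (h : Fin (k + 1)) → ContinuousMultilinearMap ℂ (fun _ : Fin (h : ℕ) => Amb n) (Alt n p)

/-- The `k`-jet at `m` of a `p`-form. -/
def jet {p : ℕ} (k : ℕ) (ω : Amb n → Alt n p) (m : Amb n) : Jet n p k :=
  fun h => iteratedFDeriv ℂ (h : ℕ) ω m

/-- The closed formal `p`-abelian relations of order `k` at `m` of the foliations tangent to
`T i`: families of `k`-jets at `m` of closed basic `p`-forms, with sum zero. -/
def formalRel {d : ℕ} (p k : ℕ) (T : Fin d → Amb n → Submodule ℂ (Amb n)) (m : Amb n) :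
    Submodule ℂ (Fin d → Jet n p k) where
  carrier := {a | (∀ i, ∃ ω ∈ closedBasic p (T i) m, jet k ω m = a i) ∧ ∑ i, a i = 0}
  zero_mem' := by
    refine ⟨fun i => ⟨0, Submodule.zero_mem _, ?_⟩, by simp⟩
    funext h
    simp [jet]
  add_mem' := by
    rintro a b ⟨ha, ha'⟩ ⟨hb, hb'⟩
    refine ⟨fun i => ?_, ?_⟩
    · obtain ⟨ω, hω, e⟩ := ha i
      obtain ⟨η, hη, e'⟩ := hb i
      refine ⟨ω + η, Submodule.add_mem _ hω hη, ?_⟩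
      rw [Pi.add_apply, ← e, ← e']
      funext h
      exact iteratedFDeriv_add_apply hω.1.contDiffAt hη.1.contDiffAt
    · change ∑ i, (a i + b i) = 0
      rw [Finset.sum_add_distrib, ha', hb']
      exact add_zero (0 : Jet n p k)
  smul_mem' := by
    rintro t a ⟨ha, ha'⟩
    refine ⟨fun i => ?_, ?_⟩
    · obtain ⟨ω, hω, e⟩ := ha i
      refine ⟨t • ω, Submodule.smul_mem _ t hω, ?_⟩
      rw [Pi.smul_apply, ← e]
      funext h
      exact iteratedFDeriv_const_smul_apply hω.1.contDiffAt
    · simp [← Finset.smul_sum, ha']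

/-- The family `R y`, `y ∈ U`, of subspaces of `V` is a holomorphic vector bundle of rank `r` on `U`
(a holomorphic subbundle of `U × V`): it has local holomorphic frames with `r` elements. -/
def IsHolomorphicSubbundle {V : Type*} [NormedAddCommGroup V] [NormedSpace ℂ V]
    (U : Set (Amb n)) (R : Amb n → Submodule ℂ V) (r : ℕ) : Prop :=
  ∀ x ∈ U, ∃ W : Set (Amb n), IsOpen W ∧ x ∈ W ∧ W ⊆ U ∧
    ∃ s : Fin r → Amb n → V, (∀ j, AnalyticOnNhd ℂ (s j) W) ∧
      ∀ y ∈ W, LinearIndependent ℂ (fun j => s j y) ∧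
        Submodule.span ℂ (Set.range fun j => s j y) = R y

/-- The space of germs at `m` of closed `p`-abelian relations of the foliations tangent to `T i`:
families of germs of closed basic `p`-forms with sum zero. -/
def germRel {d : ℕ} (p : ℕ) (T : Fin d → Amb n → Submodule ℂ (Amb n)) (m : Amb n) :
    Submodule ℂ (Fin d → Germ (𝓝 m) (Alt n p)) where
  carrier := {g | (∀ i, ∃ ω ∈ closedBasic p (T i) m, (ω : Germ (𝓝 m) (Alt n p)) = g i) ∧
    ∑ i, g i = 0}
  zero_mem' := ⟨fun i => ⟨0, Submodule.zero_mem _, rfl⟩, by simp⟩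
  add_mem' := by
    rintro a b ⟨ha, ha'⟩ ⟨hb, hb'⟩
    refine ⟨fun i => ?_, ?_⟩
    · obtain ⟨ω, hω, e⟩ := ha i
      obtain ⟨η, hη, e'⟩ := hb i
      exact ⟨ω + η, Submodule.add_mem _ hω hη, by rw [Pi.add_apply, ← e, ← e']; rfl⟩
    · simp [Finset.sum_add_distrib, ha', hb']
  smul_mem' := by
    rintro t a ⟨ha, ha'⟩
    refine ⟨fun i => ?_, ?_⟩
    · obtain ⟨ω, hω, e⟩ := ha i
      exact ⟨t • ω, Submodule.smul_mem _ t hω, by rw [Pi.smul_apply, ← e]; rfl⟩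
    · simp [← Finset.smul_sum, ha']

/-- The closed `p`-rank on `U`: the supremum over `m ∈ U` of the (possibly infinite) dimension of
the space of germs at `m` of closed `p`-abelian relations. -/
def closedRank {d : ℕ} (p : ℕ) (U : Set (Amb n)) (T : Fin d → Amb n → Submodule ℂ (Amb n)) : ℕ∞ :=
  ⨆ m ∈ U, Cardinal.toENat (Module.rank ℂ (germRel p T m))

/-- The kernel of the Koszul differential `S^k N^* ⊗ Λ^p N^* → S^{k-1} N^* ⊗ Λ^{p+1} N^*`, where
`N = ℂⁿ / S`: tensors `φ` on `ℂⁿ` that are symmetric in the first `k` arguments, alternating in the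
last `p`, vanish as soon as one argument lies in `S`, and have Koszul differential
`(v, w) ↦ ∑_l (-1)^l φ(v, w_l)(w_0, …, ŵ_l, …, w_p)` equal to zero (no condition if `k = 0`; the
vector `w_l` is put in the place `j` of `v`, and all places are equivalent by symmetry).
For `S = ⊥` this is the Koszul kernel of `ℂⁿ` itself. -/
def symbol (p k : ℕ) (S : Submodule ℂ (Amb n)) :
    Submodule ℂ (ContinuousMultilinearMap ℂ (fun _ : Fin k => Amb n) (Alt n p)) where
  carrier := {φ |
    (∀ (σ : Equiv.Perm (Fin k)) (v : Fin k → Amb n), φ (fun j => v (σ j)) = φ v) ∧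
    (∀ (v : Fin k → Amb n) (w : Fin p → Amb n),
      ((∃ j, v j ∈ S) ∨ (∃ j, w j ∈ S)) → φ v w = 0) ∧
    (∀ (j : Fin k) (v : Fin k → Amb n) (w : Fin (p + 1) → Amb n),
      ∑ l : Fin (p + 1),
        (-1 : ℂ) ^ (l : ℕ) * φ (Function.update v j (w l)) (fun a => w (l.succAbove a)) = 0)}
  zero_mem' := by simp
  add_mem' := by
    rintro a b ⟨h1, h2, h3⟩ ⟨h1', h2', h3'⟩
    refine ⟨fun σ v => ?_, fun v w hw => ?_, fun j v w => ?_⟩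
    · simp [h1 σ v, h1' σ v]
    · simp [h2 v w hw, h2' v w hw]
    · have e := h3 j v w
      have e' := h3' j v w
      simp [mul_add, Finset.sum_add_distrib, e, e']
  smul_mem' := by
    rintro t a ⟨h1, h2, h3⟩
    refine ⟨fun σ v => ?_, fun v w hw => ?_, fun j v w => ?_⟩
    · simp [h1 σ v]
    · simp [h2 v w hw]
    · have e := h3 j v w
      simp [mul_left_comm _ t, ← Finset.mul_sum, e]

theorem symbol_le (p k : ℕ) (S : Submodule ℂ (Amb n)) : symbol p k S ≤ symbol p k ⊥ := by
  rintro φ ⟨h1, -, h3⟩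
  refine ⟨h1, fun v w h => ?_, h3⟩
  rcases h with ⟨j, hj⟩ | ⟨j, hj⟩
  · rw [φ.map_coord_zero j ((Submodule.mem_bot ℂ).1 hj)]; rfl
  · exact (φ v).map_coord_zero j ((Submodule.mem_bot ℂ).1 hj)

/-- The linear map (with matrix `P̃_k` in any bases) of the system that determines the terms of
degree `k` of a closed formal abelian relation from its terms of lower degree: it sends a family
`(w_i)`, `w_i` in the Koszul kernel of `ℂⁿ / S_i`, to `∑ i, w_i` in the Koszul kernel of `ℂⁿ`. -/
def traceSymbol {d : ℕ} (p k : ℕ) (S : Fin d → Submodule ℂ (Amb n)) :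
    ((i : Fin d) → symbol p k (S i)) →ₗ[ℂ] symbol p k (⊥ : Submodule ℂ (Amb n)) :=
  ∑ i, (Submodule.inclusion (symbol_le p k (S i))).comp (LinearMap.proj i)

/-- The foliations tangent to `T i` form a strongly `p`-ordinary web of codimension `q` on `U`: at
every point of `U` and for every `k ≥ 0`, the rank of `P̃_k` is the maximal one,
`min (z(n,p,k)) (d z(q,p,k))`. -/
def StronglyOrdinary {d : ℕ} (q p : ℕ) (U : Set (Amb n))
    (T : Fin d → Amb n → Submodule ℂ (Amb n)) : Prop :=
  ∀ m ∈ U, ∀ k : ℕ,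
    (Module.finrank ℂ (LinearMap.range (traceSymbol p k fun i => T i m)) : ℤ) =
      min (z n p k) (d * z q p k)

end Web

end

/-!
The argument compares jets of closed forms with the Koszul kernels, order by order.

A closed basic form whose derivatives of order less than `h` vanish at `m` has its derivative of
order `h` in the Koszul kernel of the conormal space (`iteratedFDeriv_mem_symbol`). For a family of
closed basic forms with sum zero this gives an element of the kernel of `traceSymbol`, so spaces of
abelian relations, filtered by the order of vanishing, have a dimension bounded by the sum of the
dimensions of these kernels (`finrank_range_le_sum_relDim`). By the rank condition, the kernel in
degree `h` has dimension at most `relDim n d q p h = (d z(q,p+1,h) - z(n,p+1,h))⁺`, where the degree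
of the forms is written `p + 1`.

The numbers `z(n,p+1,k)` count the hooks: pairs of a set of `p + 1` indices and a multiset of `k`
indices, with the least index in the set. An element of the Koszul kernel is determined by its
values on hooks (`symbol_eq_zero`). Conversely each hook `(j₀, T, I)` gives the closed form
`d(x^I x_{j₀} dx_T)`, and the pullbacks of these forms under a local submersion that defines the
foliation have linearly independent jets at every point (`jet_pullForm_coeff_eq_zero`). The two
bounds agree, so these jets are a holomorphic frame of the jets of closed basic forms
(`exists_jet_eq_sum`).

In such frames the formal abelian relations of order `k` are the kernel of a holomorphic family of
matrices. For `k ≤ kOne` the bound on the kernel from above by symbols equals the bound from below by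
unknowns minus equations (`finrank_ker_frameSum`), as the equations take place in the jets of closed
forms on `ℂⁿ`. So the kernel has constant dimension, and it is a holomorphic bundle
(`exists_analytic_frame_ker`).

Above `kOne` the symbols have no relations, since the ratios `z(n,p,h) / z(q,p,h)` increase with `h`
(`ratio_strictMono`). The higher derivatives of an abelian relation are then determined by the lower
ones, and by analyticity so is its germ (`finrank_germRel_le`).
-/

noncomputable section

namespace Web

/-! ### The numbers `z(n,p,k)` and their ratios -/

section

theorem z_eq_zero_of_lt {n p k : ℕ} (h : n < p) : z n p k = 0 := by
  simp [z, Finset.Icc_eq_empty_of_lt h]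

theorem z_zero (n p : ℕ) : z n p 0 = n.choose p := by
  rcases lt_or_ge n p with h | h
  · simp [z_eq_zero_of_lt h, Nat.choose_eq_zero_of_lt h]
  · have : (Finset.Icc p n).filter (fun j => j ≤ 0 + p) = {p} := by
      ext j; simp; omega
    rw [z, this]; simp [c]

/-- The alternating sums `z n p (k + 1)` and `z n (p + 1) k` cancel except for the term `j = p`. This
is the exactness of the Koszul complex on dimensions. -/
theorem z_succ (n p k : ℕ) :
    z n p (k + 1) + z n (p + 1) k = (n.choose p : ℤ) * (c n (k + 1) : ℤ) := by
  rcases lt_or_ge n p with h | h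
  · rw [z_eq_zero_of_lt h, z_eq_zero_of_lt (by omega), Nat.choose_eq_zero_of_lt h]; simp
  · have h1 : (Finset.Icc p n).filter (fun j => j ≤ k + 1 + p) =
        insert p ((Finset.Icc (p + 1) n).filter (fun j => j ≤ k + (p + 1))) := by
      ext j; simp; omega
    unfold z
    rw [h1, Finset.sum_insert (by simp), add_assoc, ← Finset.sum_add_distrib, Finset.sum_eq_zero]
    · simp
    · intro j hj
      simp only [Finset.mem_filter, Finset.mem_Icc] at hj
      have e1 : j - p = (j - (p + 1)) + 1 := by omega
      have e2 : k + 1 + p - j = k + (p + 1) - j := by omega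
      rw [e1, e2, pow_succ]; ring

/-- The recursion of `z_succ` for the closed form of `z_eq`. -/
theorem choose_identity (n p k : ℕ) (hn : 1 ≤ n) :
    (n + (k + 1)).choose (k + 1 + (p + 1)) * (k + 1 + p).choose p
      + (n + k).choose (k + (p + 2)) * (k + (p + 1)).choose (p + 1) =
    n.choose (p + 1) * Nat.multichoose n (k + 1) := by
  rw [Nat.multichoose_eq]
  have e0 : n + (k + 1) - 1 = n + k := by omega
  rw [e0]
  have e1 : k + 1 + (p + 1) = (k + p + 1) + 1 := by omega
  have e2 : n + (k + 1) = (n + k) + 1 := by omega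
  have e3 : k + (p + 2) = k + p + 1 + 1 := by omega
  have e4 : k + 1 + p = k + p + 1 := by omega
  have e5 : k + (p + 1) = k + p + 1 := by omega
  rw [e1, e2, e3, e4, e5, Nat.choose_succ_succ (n + k) (k + p + 1)]
  -- trinomial revision, in the two forms needed
  have t1 : (n + k).choose (k + p + 1) * (k + p + 1).choose (k + 1)
      = (n + k).choose (k + 1) * (n - 1).choose p := by
    rw [Nat.choose_mul (by omega)]
    congr 2 <;> omega
  have t2 : (n + k).choose (k + p + 1 + 1) * (k + p + 2).choose (k + 1)
      = (n + k).choose (k + 1) * (n - 1).choose (p + 1) := by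
    rw [show k + p + 2 = k + p + 1 + 1 by rfl, Nat.choose_mul (by omega)]
    congr 2 <;> omega
  have s1 : (k + p + 1).choose (k + 1) = (k + p + 1).choose p :=
    Nat.choose_symm_of_eq_add (by omega)
  have s2 : (k + p + 2).choose (k + 1) = (k + p + 1).choose p + (k + p + 1).choose (p + 1) := by
    rw [← Nat.choose_succ_succ]
    exact Nat.choose_symm_of_eq_add (by omega)
  have s3 : n.choose (p + 1) = (n - 1).choose p + (n - 1).choose (p + 1) := by
    obtain ⟨m, rfl⟩ := Nat.exists_eq_add_of_le' hn
    simp [Nat.choose_succ_succ]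
  rw [s1] at t1
  rw [s2] at t2
  rw [s3]
  nlinarith [t1, t2]

/-- The alternating sum `z` in closed form: the dimension of the Schur functor of the hook with
arm `k` and leg `p`. -/
theorem z_eq (n p k : ℕ) (hn : 1 ≤ n) :
    z n (p + 1) k = ((n + k).choose (k + (p + 1)) * (k + p).choose p : ℕ) := by
  induction k generalizing p with
  | zero => rw [z_zero]; simp
  | succ k ih =>
    have h1 := z_succ n (p + 1) k
    have h2 := choose_identity n p k hn
    have h3 := ih (p + 1)
    have h4 : ((n.choose (p + 1) * Nat.multichoose n (k + 1) : ℕ) : ℤ) =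
      (n.choose (p + 1) : ℤ) * (c n (k + 1) : ℤ) := by simp [c]
    rw [← h2] at h4
    rw [← h4, h3] at h1
    push_cast at h1 ⊢
    linarith

theorem z_pos {n p : ℕ} (k : ℕ) (hp : 1 ≤ p) (hpn : p ≤ n) : 0 < z n p k := by
  obtain ⟨p, rfl⟩ := Nat.exists_eq_add_of_le' hp
  rw [z_eq n p k (by omega)]
  exact_mod_cast Nat.mul_pos (Nat.choose_pos (by omega)) (Nat.choose_pos (by omega))

/-- The ratios grow by an explicit factor that is greater than `1`. -/
theorem ratio_succ {n q p : ℕ} (h : ℕ) (hp : 1 ≤ p) (hpq : p ≤ q) (hqn : q < n) :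
    ratio n q p (h + 1) = ratio n q p h * ((n + h + 1 : ℝ) / (q + h + 1)) := by
  have key : ∀ m : ℕ, p ≤ m → (z m p (h + 1) : ℝ) * ((h + 1 + p) * (h + 1)) =
      (z m p h : ℝ) * ((m + h + 1) * (h + p)) := by
    intro m hm
    obtain ⟨p, rfl⟩ := Nat.exists_eq_add_of_le' hp
    rw [z_eq m p _ (by omega), z_eq m p _ (by omega)]
    have a1 := Nat.add_one_mul_choose_eq (m + h) (h + (p + 1))
    have a2 := Nat.add_one_mul_choose_eq (h + p) h
    have a3 : (h + p).choose h = (h + p).choose p := Nat.choose_symm_of_eq_add rfl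
    have a4 : (h + p + 1).choose (h + 1) = (h + 1 + p).choose p := by
      rw [show h + 1 + p = h + p + 1 by ring]; exact Nat.choose_symm_of_eq_add (by ring)
    rw [a3, a4] at a2
    have e1 : m + (h + 1) = m + h + 1 := by ring
    have e2 : h + 1 + (p + 1) = h + (p + 1) + 1 := by ring
    rw [e1, e2]
    have b1 := congrArg (Nat.cast (R := ℝ)) a1
    have b2 := congrArg (Nat.cast (R := ℝ)) a2
    push_cast at b1 b2 ⊢
    linear_combination (-((h + 1 + p).choose p : ℝ) * (h + 1)) * b1
      - ((m + h).choose (h + (p + 1)) : ℝ) * (m + h + 1) * b2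
  have kn := key n (by omega)
  have kq := key q hpq
  have zq : (0 : ℝ) < z q p h := by exact_mod_cast z_pos h hp hpq
  have zq' : (0 : ℝ) < z q p (h + 1) := by exact_mod_cast z_pos (h + 1) hp hpq
  have hp' : (0 : ℝ) < p := by exact_mod_cast hp
  have c1 : ((h + 1 + p) * (h + 1) : ℝ) ≠ 0 := by positivity
  have c2 : (q + h + 1 : ℝ) ≠ 0 := by positivity
  unfold ratio
  rw [div_mul_div_comm, div_eq_div_iff zq'.ne' (by positivity)]
  have c3 : ((h + 1 + p) * (h + 1) * (h + p): ℝ) ≠ 0 := by positivity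
  apply mul_left_cancel₀ c3
  linear_combination ((h + p) * (z q p h) * (q + h + 1) : ℝ) * kn
    - ((z n p h) * (n + h + 1) * (h + p) : ℝ) * kq

theorem ratio_pos {n q p : ℕ} (h : ℕ) (hp : 1 ≤ p) (hpq : p ≤ q) (hqn : q < n) :
    0 < ratio n q p h := by
  have zq : (0 : ℝ) < z q p h := by exact_mod_cast z_pos h hp hpq
  have zn : (0 : ℝ) < z n p h := by exact_mod_cast z_pos h hp (by omega)
  exact div_pos zn zq

theorem ratio_strictMono {n q p : ℕ} (hp : 1 ≤ p) (hpq : p ≤ q) (hqn : q < n) :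
    StrictMono (ratio n q p) := by
  refine strictMono_nat_of_lt_succ fun h => ?_
  rw [ratio_succ h hp hpq hqn]
  refine lt_mul_of_one_lt_right (ratio_pos h hp hpq hqn) ?_
  rw [one_lt_div (by positivity)]
  have : (q : ℝ) < n := by exact_mod_cast hqn
  linarith

/-- The ratios grow at least linearly. -/
theorem le_ratio {n q p : ℕ} (h : ℕ) (hp : 1 ≤ p) (hpq : p ≤ q) (hqn : q < n) :
    ratio n q p 0 * ((q + h + 1) / (q + 1)) ≤ ratio n q p h := by
  induction h with
  | zero =>
    have : (q + (0 : ℕ) + 1 : ℝ) / (q + 1) = 1 := by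
      rw [Nat.cast_zero, add_zero]; exact div_self (by positivity)
    rw [this, mul_one]
  | succ h ih =>
    rw [ratio_succ h hp hpq hqn]
    have hq : (q + 1 : ℝ) ≤ n := by exact_mod_cast hqn
    have h1 : (q + h + 2 : ℝ) / (q + h + 1) ≤ (n + h + 1) / (q + h + 1) := by
      gcongr ?_ / _; linarith
    calc ratio n q p 0 * ((q + (h + 1 : ℕ) + 1) / (q + 1))
        = ratio n q p 0 * ((q + h + 1) / (q + 1)) * ((q + h + 2) / (q + h + 1)) := by
          push_cast; field_simp; ring
      _ ≤ _ := mul_le_mul ih h1 (by positivity) (ratio_pos h hp hpq hqn).le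

theorem bddAbove_ratio_le {n q p : ℕ} (d : ℕ) (hp : 1 ≤ p) (hpq : p ≤ q) (hqn : q < n) :
    BddAbove {h : ℕ | ratio n q p h ≤ (d : ℝ)} := by
  have h0 := ratio_pos 0 hp hpq hqn
  obtain ⟨N, hN⟩ := exists_nat_gt ((d : ℝ) * (q + 1) / ratio n q p 0)
  refine ⟨N, fun h hh => ?_⟩
  have h1 := (le_ratio h hp hpq hqn).trans hh
  rw [div_lt_iff₀ h0] at hN
  rw [mul_div_assoc', div_le_iff₀ (by positivity)] at h1
  have h2 : (q + h + 1 : ℝ) < N := by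
    by_contra hc
    push Not at hc
    nlinarith
  have : (h : ℝ) < N := by linarith [(Nat.cast_nonneg q : (0 : ℝ) ≤ q)]
  exact_mod_cast this.le

theorem isGreatest_kOne {n d q p : ℕ} (hp : 1 ≤ p) (hpq : p ≤ q) (hqn : q < n)
    (hd : ratio n q p 0 < (d : ℝ)) :
    IsGreatest {h : ℕ | ratio n q p h ≤ (d : ℝ)} (kOne n d q p) :=
  ⟨Nat.sSup_mem ⟨0, hd.le⟩ (bddAbove_ratio_le d hp hpq hqn),
    fun _ hh => le_csSup (bddAbove_ratio_le d hp hpq hqn) hh⟩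

/-- The hooks `(j₀, T, I)`: a set `{j₀} ∪ T` of `p + 1` indices with minimum `j₀` and a multiset
`I` of `k` indices that are at least `j₀`. They index a basis of the closed `(p + 1)`-forms with
homogeneous coefficients of degree `k` in `n` variables: the coefficient of `x^I dx_{j₀} ∧ dx_T`
can be prescribed for the hooks, and determines the form. -/
abbrev Hook (n p k : ℕ) : Type :=
  Σ j₀ : Fin n, {T : Finset (Fin n) // T ∈ Finset.powersetCard p (Finset.Ioi j₀)} ×
    Sym {i : Fin n // j₀ ≤ i} k

/-- The hooks, counted by their least index. -/
theorem card_hook_eq_sum (n p k : ℕ) :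
    Fintype.card (Hook n p k) =
      ∑ m ∈ Finset.range n, m.choose p * Nat.multichoose (m + 1) k := by
  rw [Fintype.card_sigma, ← Fin.sum_univ_eq_sum_range (fun m => m.choose p * Nat.multichoose (m + 1) k),
    ← Equiv.sum_comp Fin.revPerm]
  refine Finset.sum_congr rfl fun j _ => ?_
  rw [Fintype.card_prod, Sym.card_sym_eq_multichoose, Fintype.card_coe, Finset.card_powersetCard,
    Fin.card_Ioi]
  have h1 : Fintype.card {i : Fin n // Fin.revPerm j ≤ i} = j + 1 := by
    rw [Fintype.card_subtype]
    have : (Finset.univ.filter fun i : Fin n => Fin.revPerm j ≤ i) = Finset.Ici (Fin.revPerm j) := by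
      ext; simp
    rw [this, Fin.card_Ici]
    simp [Fin.val_rev]; omega
  rw [h1]
  congr 2
  simp [Fin.val_rev]; omega

theorem card_hook (n p k : ℕ) (hn : 1 ≤ n) : (Fintype.card (Hook n p k) : ℤ) = z n (p + 1) k := by
  rw [z_eq n p k hn, card_hook_eq_sum]
  norm_cast
  clear hn
  induction n with
  | zero =>
    rw [Nat.choose_eq_zero_of_lt (by omega)]; simp
  | succ n ih =>
    rw [Finset.sum_range_succ, ih]
    have e1 : n + 1 + k = (n + k) + 1 := by ring
    rw [e1, show k + (p + 1) = (k + p) + 1 by ring, Nat.choose_succ_succ, add_mul, add_comm]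
    congr 1
    rw [Nat.multichoose_eq, show n + 1 + k - 1 = n + k by omega]
    have := Nat.choose_mul (n := n + k) (k := k + p) (s := k) (by omega)
    rw [show n + k - k = n by omega, show k + p - k = p by omega] at this
    rw [mul_comm, ← this]
    congr 1
    exact Nat.choose_symm_of_eq_add rfl

end

/-! ### Hooks and the Koszul kernel -/

section

/-- Two families with the same multiset of values differ by a permutation of the indices. -/
theorem exists_perm_comp_eq {ι α : Type*} [Fintype ι] [DecidableEq α] {f g : ι → α}
    (h : Finset.univ.val.map f = Finset.univ.val.map g) : ∃ σ : Equiv.Perm ι, g ∘ σ = f := by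
  classical
  have hc : ∀ c, Nonempty ({a // f a = c} ≃ {a // g a = c}) := by
    intro c
    refine ⟨Fintype.equivOfCardEq ?_⟩
    have := congrArg (Multiset.count c) h
    rw [Multiset.count_map, Multiset.count_map] at this
    rw [Fintype.card_subtype, Fintype.card_subtype, Finset.card_def, Finset.card_def,
      Finset.filter_val, Finset.filter_val]
    simpa only [eq_comm] using this
  exact ⟨Equiv.ofFiberEquiv fun c => (hc c).some, funext fun a => Equiv.ofFiberEquiv_map _ a⟩

/-- The vectors of the standard basis of `ℂⁿ` with indices `J a`. -/
def stdVec {n : ℕ} {ι : Type*} (J : ι → Fin n) : ι → Amb n := fun a => Pi.single (J a) 1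

/-- The indices in the multiset part of a hook, in some order. -/
def Hook.arm {n p k : ℕ} (a : Hook n p k) : Fin k → {i : Fin n // a.1 ≤ i} :=
  fun b => a.2.2.1.toList.get (b.cast (by rw [Multiset.length_toList, a.2.2.2]))

/-- The indices in the set part of a hook, in increasing order. -/
def Hook.leg {n p k : ℕ} (a : Hook n p k) : Fin (p + 1) → Fin n :=
  Fin.cons a.1 (a.2.1.1.orderEmbOfFin (Finset.mem_powersetCard.1 a.2.1.2).2)

theorem Hook.map_arm {n p k : ℕ} (a : Hook n p k) :
    Finset.univ.val.map a.arm = a.2.2.1 := by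
  have hl : a.2.2.1.toList.length = k := by rw [Multiset.length_toList, a.2.2.2]
  have : (Finset.univ.val.map a.arm : Multiset _) = (List.ofFn a.arm : Multiset _) := by
    rw [Fin.univ_val_map]
  rw [this]
  conv_rhs => rw [← Multiset.coe_toList a.2.2.1]
  congr 1
  apply List.ext_get
  · simp
  · intro i h1 h2
    simp only [Hook.arm, List.get_ofFn]
    rfl

theorem Hook.leg_zero {n p k : ℕ} (a : Hook n p k) : a.leg 0 = a.1 := rfl

theorem Hook.lt_leg_succ {n p k : ℕ} (a : Hook n p k) (i : Fin p) : a.1 < a.leg i.succ := by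
  have hT := (Finset.mem_powersetCard.1 a.2.1.2)
  exact Finset.mem_Ioi.1 (hT.1 (Finset.orderEmbOfFin_mem a.2.1.1 hT.2 i))

theorem Hook.leg_strictMono {n p k : ℕ} (a : Hook n p k) : StrictMono a.leg := by
  intro b c
  induction b using Fin.cases with
  | zero =>
    induction c using Fin.cases with
    | zero => intro h; exact absurd h (lt_irrefl _)
    | succ c => intro _; exact a.lt_leg_succ c
  | succ b =>
    induction c using Fin.cases with
    | zero => intro h; exact absurd h (Fin.not_lt_zero _)
    | succ c =>
      intro h
      exact (a.2.1.1.orderEmbOfFin _).strictMono (Fin.succ_lt_succ_iff.1 h)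

theorem Hook.range_leg {n p k : ℕ} (a : Hook n p k) :
    Set.range a.leg = insert a.1 (a.2.1.1 : Set (Fin n)) := by
  unfold Hook.leg
  rw [Fin.range_cons, Finset.range_orderEmbOfFin]

/-- A pair of an injective family `J` and a family `g` whose joint minimum is attained in `J` is
a rearrangement of a hook. -/
theorem Hook.exists_perm {n p k : ℕ} {g : Fin k → Fin n} {J : Fin (p + 1) → Fin n}
    (hJ : Function.Injective J) (a : Fin (p + 1)) (ha : ∀ b, J a ≤ J b) (hg : ∀ b, J a ≤ g b) :
    ∃ (A : Hook n p k) (σ : Equiv.Perm (Fin k)) (τ : Equiv.Perm (Fin (p + 1))),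
      (fun b => (A.arm (σ b) : Fin n)) = g ∧ A.leg ∘ τ = J := by
  classical
  set T : Finset (Fin n) := (Finset.univ.image J).erase (J a) with hTdef
  have hTmem : T ∈ Finset.powersetCard p (Finset.Ioi (J a)) := by
    rw [Finset.mem_powersetCard]
    constructor
    · intro i hi
      obtain ⟨hne, hi⟩ := Finset.mem_erase.1 hi
      obtain ⟨b, -, rfl⟩ := Finset.mem_image.1 hi
      exact Finset.mem_Ioi.2 (lt_of_le_of_ne (ha b) (Ne.symm hne))
    · rw [hTdef, Finset.card_erase_of_mem (Finset.mem_image_of_mem _ (Finset.mem_univ _)),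
        Finset.card_image_of_injective _ hJ]
      simp
  set g' : Fin k → {i : Fin n // J a ≤ i} := fun b => ⟨g b, hg b⟩
  let A : Hook n p k := ⟨J a, ⟨T, hTmem⟩, ⟨Finset.univ.val.map g', by simp⟩⟩
  obtain ⟨σ, hσ⟩ := exists_perm_comp_eq (f := g') (g := A.arm) A.map_arm.symm
  have hr : Set.range J = Set.range A.leg := by
    rw [A.range_leg]
    ext i
    simp only [A, T, Set.mem_range, Set.mem_insert_iff, Finset.coe_erase, Set.mem_sdiff,
      Finset.mem_coe, Finset.mem_image, Finset.mem_univ, true_and, Set.mem_singleton_iff]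
    by_cases hi : i = J a
    · simp [hi]
    · simp [hi]
  refine ⟨A, σ, (Equiv.ofInjective J hJ).trans ((Equiv.setCongr hr).trans
    (Equiv.ofInjective A.leg A.leg_strictMono.injective).symm), ?_, ?_⟩
  · funext b
    have := congrFun hσ b
    exact congrArg Subtype.val this
  · funext b
    exact Equiv.apply_ofInjective_symm A.leg_strictMono.injective _

variable {n : ℕ}

/-- Koszul relations move the least index of a basis tensor into the alternating part, so that an
element of the Koszul kernel is determined by its values on hooks. -/
theorem symbol_eq_zero {p k : ℕ} {S : Submodule ℂ (Amb n)}
    {φ : ContinuousMultilinearMap ℂ (fun _ : Fin k => Amb n) (Alt n (p + 1))}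
    (hφ : φ ∈ symbol (p + 1) k S)
    (h0 : ∀ A : Hook n p k, φ (stdVec fun b => (A.arm b : Fin n)) (stdVec A.leg) = 0) : φ = 0 := by
  obtain ⟨hs, -, hK⟩ := hφ
  -- the least index lies in the alternating part: a hook, up to permutations
  have vanish_min : ∀ (g : Fin k → Fin n) (J : Fin (p + 1) → Fin n), Function.Injective J →
      ∀ a, (∀ b, J a ≤ J b) → (∀ b, J a ≤ g b) → φ (stdVec g) (stdVec J) = 0 := by
    intro g J hJ a ha hg
    obtain ⟨A, σ, τ, rfl, rfl⟩ := Hook.exists_perm hJ a ha hg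
    have e1 := hs σ (stdVec fun b => (A.arm b : Fin n))
    have e2 := (φ (stdVec fun b => (A.arm b : Fin n))).toAlternatingMap.map_perm (stdVec A.leg) τ
    have e3 : φ (stdVec fun b => (A.arm (σ b) : Fin n)) = φ (stdVec fun b => (A.arm b : Fin n)) := e1
    rw [e3]
    refine Eq.trans e2 ?_
    have e4 := h0 A
    change τ.sign • (φ (stdVec fun b => (A.arm b : Fin n)) (stdVec A.leg)) = 0
    rw [e4, smul_zero]
  -- otherwise it lies in the symmetric part, and the Koszul relation moves it to the other side
  have vanish_inj : ∀ (g : Fin k → Fin n) (J : Fin (p + 1) → Fin n), Function.Injective J →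
      φ (stdVec g) (stdVec J) = 0 := by
    intro g J hJ
    obtain ⟨a, ha⟩ := Finite.exists_min J
    by_cases hg : ∀ b, J a ≤ g b
    · exact vanish_min g J hJ a ha hg
    push Not at hg
    obtain ⟨b1, hb1⟩ := hg
    have : Nonempty (Fin k) := ⟨b1⟩
    obtain ⟨b, hb⟩ := Finite.exists_min g
    have hbJ : ∀ i, g b < J i := fun i => ((hb b1).trans_lt hb1).trans_le (ha i)
    have hinj : Function.Injective (Fin.cons (g b) J : Fin (p + 2) → Fin n) :=
      Fin.cons_injective_iff.2 ⟨fun ⟨i, hi⟩ => (hbJ i).ne' hi, hJ⟩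
    have key := hK b (stdVec g) (stdVec (Fin.cons (g b) J : Fin (p + 2) → Fin n))
    rw [Fin.sum_univ_succ, Finset.sum_eq_zero, add_zero] at key
    · have e1 : Function.update (stdVec g) b (stdVec (Fin.cons (g b) J : Fin (p + 2) → Fin n) 0)
          = stdVec g := by
        rw [Function.update_eq_self_iff]; rfl
      rw [e1] at key
      simp only [Fin.val_zero, pow_zero, one_mul, Fin.succAbove_zero] at key
      exact key
    · intro l _
      have e1 : Function.update (stdVec g) b
          (stdVec (Fin.cons (g b) J : Fin (p + 2) → Fin n) l.succ)
          = stdVec (Function.update g b (J l)) := by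
        funext i
        by_cases hi : i = b
        · subst hi; simp [stdVec]
        · simp [stdVec, hi]
      rw [e1]
      have := vanish_min (Function.update g b (J l))
        (fun i => (Fin.cons (g b) J : Fin (p + 2) → Fin n) (l.succ.succAbove i))
        (hinj.comp Fin.succAbove_right_injective) 0 ?_ ?_
      · have h2 : φ (stdVec (Function.update g b (J l)))
          (fun a => stdVec (Fin.cons (g b) J : Fin (p + 2) → Fin n) (l.succ.succAbove a)) = 0 := this
        rw [h2, mul_zero]
      · intro i
        rw [Fin.succ_succAbove_zero, Fin.cons_zero]
        generalize l.succ.succAbove i = j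
        induction j using Fin.cases with
        | zero => simp
        | succ j => simpa using (hbJ j).le
      · intro i
        rw [Fin.succ_succAbove_zero, Fin.cons_zero]
        by_cases hi : i = b
        · subst hi; simpa using (hbJ l).le
        · simpa [hi] using hb i
  have vanish_basis : ∀ g : Fin k → Fin n, φ (stdVec g) = 0 := by
    intro g
    apply ContinuousAlternatingMap.toAlternatingMap_injective
    refine Module.Basis.ext_alternating (Pi.basisFun ℂ (Fin n)) fun J hJ => ?_
    have : (fun i => (Pi.basisFun ℂ (Fin n)) (J i)) = stdVec J := by
      funext i; simp [stdVec, Pi.basisFun_apply]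
    rw [this]
    exact vanish_inj g J hJ
  apply ContinuousMultilinearMap.toMultilinearMap_injective
  refine Module.Basis.ext_multilinear (fun _ => Pi.basisFun ℂ (Fin n)) fun g => ?_
  have : (fun i => (Pi.basisFun ℂ (Fin n)) (g i)) = stdVec g := by
    funext i; simp [stdVec, Pi.basisFun_apply]
  rw [this]
  exact vanish_basis g

/-- The additive group structure underlying the module structure of `symbol p k S`. -/
instance (p k : ℕ) (S : Submodule ℂ (Amb n)) : AddCommGroup (symbol p k S) :=
  Module.addCommMonoidToAddCommGroup ℂ

/-- The values of a tensor on the hooks. -/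
def hookValues (n p k : ℕ) (S : Submodule ℂ (Amb n)) :
    symbol (p + 1) k S →ₗ[ℂ] (Hook n p k → ℂ) where
  toFun φ A := φ.1 (stdVec fun b => (A.arm b : Fin n)) (stdVec A.leg)
  map_add' _ _ := rfl
  map_smul' _ _ := rfl

theorem hookValues_injective (n p k : ℕ) (S : Submodule ℂ (Amb n)) :
    Function.Injective (hookValues n p k S) := by
  rw [injective_iff_map_eq_zero]
  intro φ h
  exact Subtype.ext (symbol_eq_zero φ.2 fun A => congrFun h A)

instance (p k : ℕ) (S : Submodule ℂ (Amb n)) : FiniteDimensional ℂ (symbol (p + 1) k S) :=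
  FiniteDimensional.of_injective _ (hookValues_injective n p k S)

theorem finrank_symbol_le_card_hook (p k : ℕ) (S : Submodule ℂ (Amb n)) :
    Module.finrank ℂ (symbol (p + 1) k S) ≤ Fintype.card (Hook n p k) := by
  simpa using LinearMap.finrank_le_finrank_of_injective (hookValues_injective n p k S)

/-- A multilinear map that vanishes as soon as one argument lies in `S` is unchanged when its
arguments move within their classes modulo `S`. -/
theorem _root_.MultilinearMap.map_eq_of_sub_mem {R ι M N : Type*} [CommRing R] [AddCommGroup M]
    [Module R M] [AddCommGroup N] [Module R N] [Fintype ι] (S : Submodule R M)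
    (f : MultilinearMap R (fun _ : ι => M) N) (hf : ∀ v, (∃ j, v j ∈ S) → f v = 0)
    {v v' : ι → M} (h : ∀ j, v' j - v j ∈ S) : f v' = f v := by
  classical
  have : ∀ s : Finset ι, f (s.piecewise v' v) = f v := by
    intro s
    induction s using Finset.induction_on with
    | empty => simp
    | insert a s has ih =>
      rw [Finset.piecewise_insert, ← ih]
      have e : v' a = v a + (v' a - v a) := by abel
      rw [e, f.map_update_add, hf (Function.update (s.piecewise v' v) a (v' a - v a)) ⟨a, by simpa using h a⟩, add_zero]
      congr 1
      rw [Function.update_eq_self_iff, Finset.piecewise_eq_of_notMem _ _ _ has]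
  simpa using this Finset.univ

/-- Pullback of tensors along a linear map `R`. -/
def pullTensor {m : ℕ} (p k : ℕ) (R : Amb m →L[ℂ] Amb n) :
    ContinuousMultilinearMap ℂ (fun _ : Fin k => Amb n) (Alt n p) →ₗ[ℂ]
      ContinuousMultilinearMap ℂ (fun _ : Fin k => Amb m) (Alt m p) where
  toFun φ := (ContinuousAlternatingMap.compContinuousLinearMapCLM R).compContinuousMultilinearMap
    (φ.compContinuousLinearMap fun _ => R)
  map_add' _ _ := by ext; simp
  map_smul' _ _ := by ext; simp

theorem pullTensor_apply {m : ℕ} (p k : ℕ) (R : Amb m →L[ℂ] Amb n)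
    (φ : ContinuousMultilinearMap ℂ (fun _ : Fin k => Amb n) (Alt n p))
    (v : Fin k → Amb m) (w : Fin p → Amb m) :
    pullTensor p k R φ v w = φ (fun j => R (v j)) (fun j => R (w j)) := rfl

/-- Pullback along a right inverse of `L` embeds the Koszul kernel of `ℂⁿ / ker L` into that of `ℂ^q`. -/
theorem finrank_symbol_ker_le {q : ℕ} (p k : ℕ) (L : Amb n →L[ℂ] Amb q)
    (hL : Function.Surjective L) :
    Module.finrank ℂ (symbol (p + 1) k (LinearMap.ker (L : Amb n →ₗ[ℂ] Amb q))) ≤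
      Fintype.card (Hook q p k) := by
  obtain ⟨R₀, hR₀⟩ := (L : Amb n →ₗ[ℂ] Amb q).exists_rightInverse_of_surjective
    (LinearMap.range_eq_top.2 hL)
  let R : Amb q →L[ℂ] Amb n := LinearMap.toContinuousLinearMap R₀
  have hR : ∀ x, L (R x) = x := fun x => LinearMap.congr_fun hR₀ x
  have hmem : ∀ φ ∈ symbol (p + 1) k (LinearMap.ker (L : Amb n →ₗ[ℂ] Amb q)),
      pullTensor (p + 1) k R φ ∈ symbol (p + 1) k (⊥ : Submodule ℂ (Amb q)) := by
    rintro φ ⟨h1, h2, h3⟩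
    refine ⟨fun σ v => ?_, fun v w h => ?_, fun j v w => ?_⟩
    · ext w
      rw [pullTensor_apply, pullTensor_apply, ← h1 σ fun j => R (v j)]
    · rw [pullTensor_apply]
      apply h2
      refine h.imp ?_ ?_
      all_goals
        rintro ⟨j, hj⟩
        refine ⟨j, ?_⟩
        rw [(Submodule.mem_bot ℂ).1 hj, map_zero]
        exact Submodule.zero_mem _
    · have := h3 j (fun i => R (v i)) (fun i => R (w i))
      rw [← this]
      refine Finset.sum_congr rfl fun l _ => ?_
      rw [pullTensor_apply]
      congr 3
      funext i
      by_cases hi : i = j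
      · subst hi; simp
      · simp [hi]
  let Φ := ((pullTensor (p + 1) k R).restrict hmem)
  have hinj : Function.Injective Φ := by
    rw [injective_iff_map_eq_zero]
    rintro ⟨φ, hφ⟩ h0
    have h2 := hφ.2.1
    have h0' : pullTensor (p + 1) k R φ = 0 := congrArg Subtype.val h0
    apply Subtype.ext
    have hsub : ∀ x, x - R (L x) ∈ LinearMap.ker (L : Amb n →ₗ[ℂ] Amb q) := by
      intro x
      rw [LinearMap.mem_ker]
      simp [hR]
    ext v w
    have e1 : φ v = φ fun j => R (L (v j)) :=
      φ.toMultilinearMap.map_eq_of_sub_mem _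
        (fun v hv => by ext w; exact h2 v w (Or.inl hv)) fun j => hsub (v j)
    have e2 : φ (fun j => R (L (v j))) w = φ (fun j => R (L (v j))) (fun j => R (L (w j))) :=
      (φ fun j => R (L (v j))).toMultilinearMap.map_eq_of_sub_mem _
        (fun w hw => h2 _ w (Or.inr hw)) fun j => hsub (w j)
    rw [e1, e2, ← pullTensor_apply (p + 1) k R φ (fun j => L (v j)) (fun j => L (w j)), h0']
    rfl
  exact (LinearMap.finrank_le_finrank_of_injective hinj).trans
    (finrank_symbol_le_card_hook p k ⊥)

end

/-! ### Leading derivatives of closed basic forms -/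

section

section Vanishing

variable {E F : Type*} [NormedAddCommGroup E] [NormedSpace ℂ E] [NormedAddCommGroup F]
  [NormedSpace ℂ F] [CompleteSpace F] {f : E → F} {m : E} {h : ℕ}

theorem isBigO_pow_of_iteratedFDeriv_eq_zero (hf : AnalyticAt ℂ f m)
    (h0 : ∀ j < h, iteratedFDeriv ℂ j f m = 0) :
    f =O[𝓝 m] fun x => ‖x - m‖ ^ h := by
  obtain ⟨p, r, hp⟩ := hf
  have hO := hp.hasFPowerSeriesAt.isBigO_sub_partialSum_pow h
  have hz : ∀ y, p.partialSum h y = 0 := by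
    intro y
    refine Finset.sum_eq_zero fun j hj => ?_
    have e := hp.factorial_smul y j
    rw [h0 j (Finset.mem_range.1 hj), zero_apply, ← Nat.cast_smul_eq_nsmul ℂ] at e
    exact (smul_eq_zero.1 e).resolve_left (Nat.cast_ne_zero.2 j.factorial_ne_zero)
  simp only [hz, sub_zero] at hO
  have ht : Tendsto (fun x => x - m) (𝓝 m) (𝓝 0) := by
    simpa using (continuous_sub_right m).tendsto m
  simpa [Function.comp_def] using hO.comp_tendsto ht

theorem iteratedFDeriv_eq_zero_of_isBigO_pow (hf : AnalyticAt ℂ f m)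
    (hO : f =O[𝓝 m] fun x => ‖x - m‖ ^ h) {j : ℕ} (hj : j < h) :
    iteratedFDeriv ℂ j f m = 0 := by
  obtain ⟨p, r, hp⟩ := hf
  have ht : Tendsto (fun y => m + y) (𝓝 0) (𝓝 m) := by
    simpa using (continuous_const_add m).tendsto (0 : E)
  have hO' : (fun y => f (m + y)) =O[𝓝 0] fun y => ‖y‖ ^ h := by
    simpa [Function.comp_def] using hO.comp_tendsto ht
  have hz : ∀ i < h, ∀ y, p i (fun _ => y) = 0 := by
    intro i
    induction i using Nat.strong_induction_on with
    | _ i ih =>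
      intro hi
      apply Asymptotics.IsBigO.continuousMultilinearMap_apply_eq_zero
      have h1 := hp.hasFPowerSeriesAt.isBigO_sub_partialSum_pow (i + 1)
      have h2 : (fun y : E => ‖y‖ ^ h) =O[𝓝 0] fun y => ‖y‖ ^ (i + 1) := by
        refine Asymptotics.IsBigO.of_bound 1 ?_
        filter_upwards [Metric.ball_mem_nhds (0 : E) one_pos] with y hy
        have hy' : ‖y‖ ≤ 1 := by simpa using (mem_ball_zero_iff.1 hy).le
        rw [norm_pow, norm_norm, norm_pow, norm_norm, one_mul]
        exact pow_le_pow_of_le_one (norm_nonneg _) hy' hi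
      refine ((hO'.trans h2).sub h1).congr_left fun y => ?_
      rw [FormalMultilinearSeries.partialSum, Finset.sum_range_succ, Finset.sum_eq_zero]
      · simp
      · exact fun l hl => ih l (Finset.mem_range.1 hl) ((Finset.mem_range.1 hl).trans hi) y
  -- the terms of degree `< h` do not contribute to the sum of the series: replace them by zero
  let p' : FormalMultilinearSeries ℂ E F := fun i => if i < h then 0 else p i
  have hp' : HasFPowerSeriesOnBall f p' m r := by
    refine ⟨hp.r_le.trans (FormalMultilinearSeries.radius_le_of_le fun i => ?_), hp.r_pos,
      fun {y} hy => (hp.hasSum hy).congr_fun ?_⟩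
    · by_cases hi : i < h <;> simp [p', hi]
    · intro i
      by_cases hi : i < h
      · simp [p', hi, hz i hi y]
      · simp [p', hi]
  ext v
  rw [hp'.iteratedFDeriv_eq_sum_of_completeSpace]
  simp [p', hj]

end Vanishing

variable {n : ℕ}

/-- The Koszul relation for the derivative of order `h + 1` is the derivative of order `h` of the
equation `dω = 0`. -/
theorem iteratedFDeriv_mem_symbol_bot {p : ℕ} {ω : Amb n → Alt n p} {m : Amb n}
    (hω : AnalyticAt ℂ ω m) (hcl : ∀ᶠ y in 𝓝 m, extDeriv ω y = 0) (h : ℕ) :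
    iteratedFDeriv ℂ h ω m ∈ symbol p h (⊥ : Submodule ℂ (Amb n)) := by
  refine ⟨fun σ v => hω.contDiffAt.iteratedFDeriv_comp_perm v σ, fun v w hvw => ?_,
    fun j v w => ?_⟩
  · rcases hvw with ⟨j, hj⟩ | ⟨j, hj⟩
    · rw [ContinuousMultilinearMap.map_coord_zero _ j ((Submodule.mem_bot ℂ).1 hj)]; rfl
    · exact ContinuousAlternatingMap.map_coord_zero _ j ((Submodule.mem_bot ℂ).1 hj)
  · obtain _ | h := h
    · exact j.elim0
    let A := ContinuousAlternatingMap.alternatizeUncurryFinCLM (n := p) ℂ (Amb n) ℂ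
    have h1 : iteratedFDeriv ℂ h (extDeriv ω) m = 0 := by
      have : extDeriv ω =ᶠ[𝓝 m] fun _ => 0 := hcl
      rw [(Filter.EventuallyEq.iteratedFDeriv ℂ this h).eq_of_nhds]
      exact congrFun iteratedFDeriv_fun_zero m
    have h2 := A.iteratedFDeriv_comp_left (i := h) (n := ⊤) hω.fderiv.contDiffAt le_top
    have h3 : A ∘ fderiv ℂ ω = extDeriv ω := rfl
    rw [h3, h1] at h2
    set v' : Fin h → Amb n := Fin.init (v ∘ Equiv.swap j (Fin.last h)) with hv'
    have h4 : ∀ x, Function.update v j x ∘ Equiv.swap j (Fin.last h) =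
        (Fin.snoc v' x : Fin (h + 1) → Amb n) := by
      intro x
      funext i
      induction i using Fin.lastCases with
      | last => simp
      | cast i =>
        rw [Fin.snoc_castSucc, hv', Function.comp_apply]
        have : Equiv.swap j (Fin.last h) i.castSucc ≠ j := by
          intro hc
          rw [Equiv.swap_apply_eq_iff, Equiv.swap_apply_left] at hc
          exact (Fin.castSucc_lt_last i).ne hc
        rw [Function.update_of_ne this]
        rfl
    have h5 := congrArg (fun Φ => Φ v' w) h2
    change (0 : ℂ) = A (iteratedFDeriv ℂ h (fderiv ℂ ω) m v') w at h5
    rw [ContinuousAlternatingMap.alternatizeUncurryFinCLM_apply,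
      ContinuousAlternatingMap.alternatizeUncurryFin_apply] at h5
    rw [h5]
    refine Finset.sum_congr rfl fun l _ => ?_
    have h6 : iteratedFDeriv ℂ (h + 1) ω m (Function.update v j (w l)) =
        iteratedFDeriv ℂ h (fderiv ℂ ω) m v' (w l) := by
      rw [← hω.contDiffAt.iteratedFDeriv_comp_perm _ (Equiv.swap j (Fin.last h)), h4,
        iteratedFDeriv_succ_apply_right, Fin.init_snoc, Fin.snoc_last]
    rw [h6, zsmul_eq_mul]
    push_cast
    rfl

/-- The right inverses of the differentials of a submersion can be chosen continuously. -/
theorem exists_rightInverse_field {q : ℕ} {u : Amb n → Amb q} {m : Amb n} (hu : AnalyticAt ℂ u m)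
    (hs : Function.Surjective (fderiv ℂ u m)) :
    ∃ S : Amb n → (Amb q →L[ℂ] Amb n), ContinuousAt S m ∧
      ∀ᶠ y in 𝓝 m, ∀ x, fderiv ℂ u y (S y x) = x := by
  obtain ⟨R₀, hR₀⟩ := (fderiv ℂ u m : Amb n →ₗ[ℂ] Amb q).exists_rightInverse_of_surjective
    (LinearMap.range_eq_top.2 hs)
  let R : Amb q →L[ℂ] Amb n := LinearMap.toContinuousLinearMap R₀
  let A : Amb n → (Amb q →L[ℂ] Amb q) := fun y => (fderiv ℂ u y).comp R
  have hAm : A m = 1 := by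
    ext x : 1
    exact LinearMap.congr_fun hR₀ x
  have hA : ContinuousAt A m := hu.fderiv.continuousAt.clm_comp continuousAt_const
  have hunit : IsUnit (A m) := hAm ▸ isUnit_one
  have hinv : ContinuousAt (fun y => Ring.inverse (A y)) m := by
    have h1 : ContinuousAt Ring.inverse (A m) := by
      obtain ⟨U, hU⟩ := hunit
      rw [← hU]
      exact NormedRing.inverse_continuousAt U
    exact h1.comp hA
  refine ⟨fun y => R.comp (Ring.inverse (A y)), continuousAt_const.clm_comp hinv, ?_⟩
  filter_upwards [hA.eventually (Units.isOpen.mem_nhds hunit)] with y hy x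
  exact DFunLike.congr_fun (Ring.mul_inverse_cancel (A y) hy) x

/-- A vector tangent to the fibre of a submersion extends to a tangent vector field that differs
from it by `O(y - m)`. -/
theorem exists_tangent_field {q : ℕ} {u : Amb n → Amb q} {m : Amb n} (hu : AnalyticAt ℂ u m)
    (hs : Function.Surjective (fderiv ℂ u m)) {x₀ : Amb n} (hx : fderiv ℂ u m x₀ = 0) :
    ∃ X : Amb n → Amb n, (∀ᶠ y in 𝓝 m, fderiv ℂ u y (X y) = 0) ∧
      (fun y => x₀ - X y) =O[𝓝 m] fun y => y - m := by
  obtain ⟨S, hS, hS'⟩ := exists_rightInverse_field hu hs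
  refine ⟨fun y => x₀ - S y (fderiv ℂ u y x₀), ?_, ?_⟩
  · filter_upwards [hS'] with y hy
    rw [map_sub, hy, sub_self]
  · have h1 : (fun y => fderiv ℂ u y x₀) =O[𝓝 m] fun y => y - m := by
      have hd : DifferentiableAt ℂ (fun y => fderiv ℂ u y x₀) m :=
        hu.fderiv.differentiableAt.clm_apply (differentiableAt_const _)
      simpa [hx] using hd.isBigO_sub
    have h2 : S =O[𝓝 m] fun _ => (1 : ℝ) := hS.tendsto.isBigO_one ℝ
    have h3 : (fun y => S y (fderiv ℂ u y x₀)) =O[𝓝 m] fun y => ‖S y‖ * ‖fderiv ℂ u y x₀‖ :=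
      Asymptotics.IsBigO.of_bound 1 (Eventually.of_forall fun y => by
        rw [one_mul, norm_mul, norm_norm, norm_norm]
        exact (S y).le_opNorm _)
    have h4 := h3.trans (h2.norm_left.mul h1.norm_norm)
    simp only [one_mul] at h4
    simpa using h4

/-- The leading derivative at `m` of a form that is semi-basic near `m` is semi-basic. -/
theorem iteratedFDeriv_apply_eq_zero_of_semiBasic {p q : ℕ} {u : Amb n → Amb q} {m : Amb n}
    {T : Amb n → Submodule ℂ (Amb n)} (hu : AnalyticAt ℂ u m)
    (hs : Function.Surjective (fderiv ℂ u m))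
    (hT : ∀ᶠ y in 𝓝 m, T y = LinearMap.ker (fderiv ℂ u y : Amb n →ₗ[ℂ] Amb q))
    {ω : Amb n → Alt n p} (hω : AnalyticAt ℂ ω m) (hb : ∀ᶠ y in 𝓝 m, SemiBasicAt T ω y)
    {h : ℕ} (h0 : ∀ j < h, iteratedFDeriv ℂ j ω m = 0)
    (v : Fin h → Amb n) (w : Fin p → Amb n) (hw : ∃ j, w j ∈ T m) :
    iteratedFDeriv ℂ h ω m v w = 0 := by
  obtain ⟨j, hj⟩ := hw
  rw [hT.self_of_nhds, LinearMap.mem_ker] at hj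
  obtain ⟨X, hX, hXO⟩ := exists_tangent_field hu hs hj
  let ev := ContinuousAlternatingMap.apply ℂ (Amb n) ℂ w
  have hg : AnalyticAt ℂ (ev ∘ ω) m := ev.analyticAt _ |>.comp hω
  have hgO : (ev ∘ ω) =O[𝓝 m] fun y => ‖y - m‖ ^ (h + 1) := by
    have h1 : ev ∘ ω =ᶠ[𝓝 m] fun y => ω y (Function.update w j (w j - X y)) := by
      filter_upwards [hb, hT, hX] with y hy hTy hXy
      have h2 : ω y (Function.update w j (X y)) = 0 := by
        apply hy
        refine ⟨j, ?_⟩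
        rw [Function.update_self, hTy]
        exact hXy
      rw [ContinuousAlternatingMap.map_update_sub, h2, sub_zero, Function.update_eq_self]
      rfl
    refine h1.trans_isBigO ?_
    have h3 : (fun y => ω y (Function.update w j (w j - X y))) =O[𝓝 m]
        fun y => ‖ω y‖ * ‖w j - X y‖ := by
      refine Asymptotics.IsBigO.of_bound (∏ i ∈ Finset.univ \ {j}, ‖w i‖)
        (Eventually.of_forall fun y => ?_)
      refine ((ω y).le_opNorm _).trans (le_of_eq ?_)
      have : (fun i => ‖Function.update w j (w j - X y) i‖) =
          Function.update (fun i => ‖w i‖) j ‖w j - X y‖ := by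
        funext i
        by_cases hi : i = j
        · subst hi; simp
        · simp [hi]
      rw [this, Finset.prod_update_of_mem (Finset.mem_univ j), norm_mul, norm_norm, norm_norm]
      ring
    have h4 := isBigO_pow_of_iteratedFDeriv_eq_zero hω h0
    simp only [pow_succ]
    exact h3.trans (h4.norm_left.mul hXO.norm_norm)
  have h5 := iteratedFDeriv_eq_zero_of_isBigO_pow hg hgO (Nat.lt_succ_self h)
  rw [ev.iteratedFDeriv_comp_left (n := ⊤) hω.contDiffAt le_top] at h5
  exact congrArg (fun Φ => Φ v) h5

/-- The leading derivative of a closed basic form lies in the Koszul kernel of the conormal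
space. -/
theorem iteratedFDeriv_mem_symbol {p q : ℕ} {u : Amb n → Amb q} {m : Amb n}
    {T : Amb n → Submodule ℂ (Amb n)} (hu : AnalyticAt ℂ u m)
    (hs : Function.Surjective (fderiv ℂ u m))
    (hT : ∀ᶠ y in 𝓝 m, T y = LinearMap.ker (fderiv ℂ u y : Amb n →ₗ[ℂ] Amb q))
    {ω : Amb n → Alt n (p + 1)} (hω : ω ∈ closedBasic (p + 1) T m)
    {h : ℕ} (h0 : ∀ j < h, iteratedFDeriv ℂ j ω m = 0) :
    iteratedFDeriv ℂ h ω m ∈ symbol (p + 1) h (T m) := by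
  obtain ⟨h1, -, h3⟩ := iteratedFDeriv_mem_symbol_bot hω.1 (hω.2.mono fun y hy => hy.2.2) h
  have h2 := iteratedFDeriv_apply_eq_zero_of_semiBasic hu hs hT hω.1 (hω.2.mono fun y hy => hy.1) h0
  refine ⟨h1, fun v w hvw => ?_, h3⟩
  rcases hvw with ⟨j, hj⟩ | hw
  · -- the Koszul relation moves the vector of `T m` into the alternating part
    have key := h3 j v (Fin.cons (v j) w)
    rw [Fin.sum_univ_succ, Finset.sum_eq_zero, add_zero] at key
    · simpa using key
    · intro l _
      rw [h2 _ _ ⟨0, ?_⟩, mul_zero]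
      simpa using hj
  · exact h2 v w hw

end

/-! ### The closed polynomial forms of the hooks -/

section

variable {q : ℕ}

/-- The form `dx_{J 0} ∧ ⋯ ∧ dx_{J (p-1)}`. -/
def coordForm {p : ℕ} (J : Fin p → Fin q) : Alt q p where
  toMultilinearMap :=
    (Matrix.detRowAlternating.compLinearMap (LinearMap.funLeft ℂ ℂ J)).toMultilinearMap
  cont := by
    change Continuous fun v : Fin p → Amb q => Matrix.det fun a b => v a (J b)
    refine Continuous.matrix_det ?_
    fun_prop
  map_eq_zero_of_eq' :=
    (Matrix.detRowAlternating.compLinearMap (LinearMap.funLeft ℂ ℂ J)).map_eq_zero_of_eq'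

theorem coordForm_apply {p : ℕ} (J : Fin p → Fin q) (v : Fin p → Amb q) :
    coordForm J v = Matrix.det fun a b => v a (J b) := rfl

theorem coordForm_stdVec_self {p : ℕ} {J : Fin p → Fin q} (hJ : StrictMono J) :
    coordForm J (stdVec J) = 1 := by
  rw [coordForm_apply, ← Matrix.det_one (n := Fin p) (R := ℂ)]
  congr 1
  ext a b
  simp only [stdVec, Pi.single_apply, Matrix.one_apply, hJ.injective.eq_iff]
  simp only [eq_comm]

/-- The coordinate forms are dual to the increasing families of basis vectors. -/
theorem eq_of_coordForm_stdVec_ne_zero {p : ℕ} {J J' : Fin p → Fin q} (hJ : StrictMono J)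
    (hJ' : StrictMono J') (h : coordForm J (stdVec J') ≠ 0) : J' = J := by
  rw [← hJ'.range_inj hJ]
  have hsub : Set.range J' ⊆ Set.range J := by
    rintro _ ⟨a, rfl⟩
    by_contra hc
    refine h (Matrix.det_eq_zero_of_row_eq_zero a fun b => ?_)
    exact Pi.single_eq_of_ne (fun hb => hc ⟨b, hb⟩) _
  refine Set.eq_of_subset_of_ncard_le hsub ?_
  rw [← Set.image_univ, ← Set.image_univ, Set.ncard_image_of_injective _ hJ.injective,
    Set.ncard_image_of_injective _ hJ'.injective]

theorem hasFDerivAt_eval (P : MvPolynomial (Fin q) ℂ) (x : Amb q) :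
    HasFDerivAt (fun y : Amb q => MvPolynomial.eval y P)
      (∑ i, MvPolynomial.eval x (MvPolynomial.pderiv i P) •
        (ContinuousLinearMap.proj i : Amb q →L[ℂ] ℂ)) x := by
  induction P using MvPolynomial.induction_on with
  | C a =>
    have h : HasFDerivAt (𝕜 := ℂ) (fun _ : Amb q => a) 0 x := hasFDerivAt_const a x
    refine (h.congr_fderiv ?_).congr_of_eventuallyEq (Eventually.of_forall fun y => by simp)
    ext v
    simp
  | add P Q hP hQ =>
    have h : HasFDerivAt
        (fun y : Amb q => MvPolynomial.eval y P + MvPolynomial.eval y Q) _ x := hP.add hQ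
    simp only [map_add]
    refine h.congr_fderiv ?_
    ext v
    simp [add_mul, Finset.sum_add_distrib]
  | mul_X P j hP =>
    have h : HasFDerivAt (fun y : Amb q => MvPolynomial.eval y P * y j) _ x :=
      hP.mul (hasFDerivAt_apply (𝕜 := ℂ) j x)
    simp only [map_mul, MvPolynomial.eval_X]
    refine h.congr_fderiv ?_
    ext v
    simp [Derivation.leibniz, MvPolynomial.pderiv_X, Pi.single_apply, add_mul, ite_mul, apply_ite,
      Finset.sum_add_distrib, Finset.mul_sum, mul_assoc]

theorem analyticAt_eval (P : MvPolynomial (Fin q) ℂ) (x : Amb q) :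
    AnalyticAt ℂ (fun y : Amb q => MvPolynomial.eval y P) x := by
  have := AnalyticAt.aeval_mvPolynomial (𝕜 := ℂ) (f := fun y : Amb q => y) (z := x)
    (fun i => (ContinuousLinearMap.proj i : Amb q →L[ℂ] ℂ).analyticAt x) P
  simpa [MvPolynomial.aeval_eq_eval] using this

namespace Hook

variable {p h : ℕ}

/-- The exponents of the monomial given by the multiset part of a hook. -/
def expo (A : Hook q p h) : Fin q →₀ ℕ := Multiset.toFinsupp (A.2.2.1.map Subtype.val)

theorem le_of_expo_ne_zero (A : Hook q p h) {i : Fin q} (hi : A.expo i ≠ 0) : A.1 ≤ i := by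
  rw [expo, Multiset.toFinsupp_apply, Multiset.count_ne_zero, Multiset.mem_map] at hi
  obtain ⟨j, -, rfl⟩ := hi
  exact j.2

theorem degree_expo (A : Hook q p h) : A.expo.degree = h := by
  have : A.expo.degree = (Finsupp.toMultiset A.expo).card := by
    rw [Finsupp.card_toMultiset]; rfl
  rw [this, expo, Multiset.toFinsupp_toMultiset, Multiset.card_map]
  exact A.2.2.2

/-- A hook is determined by its exponents and its leg. -/
theorem sigma_ext {k : ℕ} {A B : Σ h : Fin k, Hook q p h} (h1 : A.2.expo = B.2.expo)
    (h2 : A.2.leg = B.2.leg) : A = B := by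
  obtain ⟨⟨a, ha⟩, A⟩ := A
  obtain ⟨⟨b, hb⟩, B⟩ := B
  have hab : a = b :=
    (degree_expo A).symm.trans ((congrArg Finsupp.degree h1).trans (degree_expo B))
  subst hab
  congr 1
  have hr : insert A.1 (A.2.1.1 : Set (Fin q)) = insert B.1 (B.2.1.1 : Set (Fin q)) := by
    rw [← A.range_leg, ← B.range_leg]; exact congrArg _ h2
  have h0 : A.1 = B.1 := congrFun h2 0
  obtain ⟨j, ⟨T, hT⟩, I⟩ := A
  obtain ⟨j', ⟨T', hT'⟩, I'⟩ := B
  simp only at h0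
  subst h0
  congr 2
  · have n1 : j ∉ (T : Set (Fin q)) := fun hj =>
      lt_irrefl j (Finset.mem_Ioi.1 ((Finset.mem_powersetCard.1 hT).1 hj))
    have n2 : j ∉ (T' : Set (Fin q)) := fun hj =>
      lt_irrefl j (Finset.mem_Ioi.1 ((Finset.mem_powersetCard.1 hT').1 hj))
    apply Subtype.ext
    apply Finset.coe_injective
    have := congrArg (fun s => s \ {j}) hr
    simpa [Set.insert_sdiff_of_mem, Set.sdiff_singleton_eq_self n1, Set.sdiff_singleton_eq_self n2]
      using this
  · apply Subtype.ext
    have := Multiset.toFinsupp.injective h1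
    exact Multiset.map_injective Subtype.val_injective this

/-- The closed form `d(x^I x_{j₀} dx_T)` of the hook `(j₀, T, I)`. -/
def closedForm (A : Hook q p h) : Amb q → Alt q (p + 1) :=
  extDeriv fun x => MvPolynomial.eval x (MvPolynomial.monomial (A.expo + Finsupp.single A.1 1) 1) •
    coordForm fun i => A.leg i.succ

theorem analyticAt_primitive (A : Hook q p h) (x : Amb q) :
    AnalyticAt ℂ (fun x =>
      MvPolynomial.eval x (MvPolynomial.monomial (A.expo + Finsupp.single A.1 1) (1 : ℂ)) •
        coordForm fun i => A.leg i.succ) x :=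
  (analyticAt_eval _ x).smul analyticAt_const

theorem analyticAt_closedForm (A : Hook q p h) (x : Amb q) : AnalyticAt ℂ A.closedForm x := by
  let L := ContinuousAlternatingMap.alternatizeUncurryFinCLM (n := p) ℂ (Amb q) ℂ
  exact (L.analyticAt _).comp (A.analyticAt_primitive x).fderiv

theorem extDeriv_closedForm (A : Hook q p h) (x : Amb q) : extDeriv A.closedForm x = 0 :=
  extDeriv_extDeriv_apply (r := ⊤) (A.analyticAt_primitive x).contDiffAt (by simp)

/-- The polynomial `x ↦ ω_x(e_J)`, for `ω` the closed form of a hook. -/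
def coeffPoly (A : Hook q p h) (J : Fin (p + 1) → Fin q) : MvPolynomial (Fin q) ℂ :=
  ∑ l : Fin (p + 1), ((-1) ^ (l : ℕ) *
    coordForm (fun i => A.leg i.succ) (stdVec fun i => J (l.succAbove i))) •
    MvPolynomial.pderiv (J l) (MvPolynomial.monomial (A.expo + Finsupp.single A.1 1) 1)

theorem closedForm_stdVec (A : Hook q p h) (J : Fin (p + 1) → Fin q) (x : Amb q) :
    A.closedForm x (stdVec J) = MvPolynomial.eval x (A.coeffPoly J) := by
  rw [closedForm, extDeriv_apply (A.analyticAt_primitive x).differentiableAt, coeffPoly, map_sum]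
  refine Finset.sum_congr rfl fun l _ => ?_
  have h1 := (hasFDerivAt_eval (MvPolynomial.monomial (A.expo + Finsupp.single A.1 1) 1) x).mul_const
    (coordForm (fun i => A.leg i.succ) (l.removeNth (stdVec J)))
  have h2 := h1.fderiv
  simp only [ContinuousAlternatingMap.smul_apply, smul_eq_mul]
  rw [h2]
  have h3 : l.removeNth (stdVec J) = stdVec fun i => J (l.succAbove i) := rfl
  rw [h3, MvPolynomial.smul_eval]
  simp [stdVec, Pi.single_apply]
  ring

theorem totalDegree_coeffPoly_le (A : Hook q p h) (J : Fin (p + 1) → Fin q) :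
    (A.coeffPoly J).totalDegree ≤ h := by
  refine MvPolynomial.totalDegree_finsetSum_le fun l _ => ?_
  refine (MvPolynomial.totalDegree_smul_le _ _).trans ?_
  rw [MvPolynomial.pderiv_monomial]
  by_cases hc : (A.expo + Finsupp.single A.1 1 : Fin q →₀ ℕ) (J l) = 0
  · simp [hc]
  refine (MvPolynomial.totalDegree_monomial_le _ _).trans ?_
  have h1 : (A.expo + Finsupp.single A.1 1 - Finsupp.single (J l) 1) + Finsupp.single (J l) 1 =
      A.expo + Finsupp.single A.1 1 := by
    apply tsub_add_cancel_of_le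
    rw [Finsupp.single_le_iff]
    exact Nat.one_le_iff_ne_zero.2 hc
  have h2 := congrArg Finsupp.degree h1
  rw [map_add, map_add, Finsupp.degree_single, Finsupp.degree_single, A.degree_expo] at h2
  exact (Nat.add_right_cancel h2).le

/-- The hook coefficients of the closed forms of the hooks form a diagonal matrix. -/
theorem eq_of_term_ne_zero {k : ℕ} {A B : Σ h : Fin k, Hook q p h} {l : Fin (p + 1)}
    (h1 : coordForm (fun i => A.2.leg i.succ) (stdVec fun i => B.2.leg (l.succAbove i)) ≠ 0)
    (h2 : (MvPolynomial.pderiv (B.2.leg l) (MvPolynomial.monomial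
      (A.2.expo + Finsupp.single A.2.1 1) (1 : ℂ))).coeff B.2.expo ≠ 0) :
    A = B ∧ l = 0 := by
  have htail := eq_of_coordForm_stdVec_ne_zero
    (J := fun i => A.2.leg i.succ) (J' := fun i => B.2.leg (l.succAbove i))
    (fun i j hij => A.2.leg_strictMono (Fin.succ_lt_succ_iff.2 hij))
    (fun i j hij => B.2.leg_strictMono (Fin.strictMono_succAbove l hij)) h1
  rw [MvPolynomial.pderiv_monomial, MvPolynomial.coeff_monomial] at h2
  have hexp : A.2.expo + Finsupp.single A.2.1 1 - Finsupp.single (B.2.leg l) 1 = B.2.expo := by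
    by_contra hc; exact h2 (if_neg hc)
  rw [if_pos hexp] at h2
  have hne : (A.2.expo + Finsupp.single A.2.1 1 : Fin q →₀ ℕ) (B.2.leg l) ≠ 0 := by
    intro hc; exact h2 (by rw [hc]; simp)
  have hexp' : A.2.expo + Finsupp.single A.2.1 1 = B.2.expo + Finsupp.single (B.2.leg l) 1 := by
    rw [← hexp, tsub_add_cancel_of_le]
    rw [Finsupp.single_le_iff]
    exact Nat.one_le_iff_ne_zero.2 hne
  by_cases hi : B.2.leg l = A.2.1
  · have hE : A.2.expo = B.2.expo := by
      rw [hi] at hexp'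
      exact add_right_cancel hexp'
    have hl : A.2.leg = B.2.leg := by
      rw [← A.2.leg_strictMono.range_inj B.2.leg_strictMono]
      have r1 : Set.range A.2.leg = insert (A.2.1) (Set.range fun i : Fin p => A.2.leg i.succ) := by
        conv_lhs => rw [← Fin.cons_self_tail A.2.leg, Fin.range_cons]
        rfl
      have r2 : Set.range B.2.leg = insert (B.2.leg l) (Set.range fun i : Fin p => B.2.leg (l.succAbove i)) := by
        conv_lhs => rw [← Fin.insertNth_self_removeNth l B.2.leg, Fin.range_insertNth]
        rfl
      rw [r1, r2, hi, htail]
    have hAB := sigma_ext hE hl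
    refine ⟨hAB, B.2.leg_strictMono.injective ?_⟩
    rw [hi, ← hl, leg_zero]
  · exfalso
    have hA : A.2.expo (B.2.leg l) ≠ 0 := by
      simpa [Finsupp.single_apply, Ne.symm hi] using hne
    have hlt : A.2.1 < B.2.leg l := lt_of_le_of_ne (A.2.le_of_expo_ne_zero hA) (Ne.symm hi)
    have hB : B.2.expo A.2.1 ≠ 0 := by
      have := DFunLike.congr_fun hexp' A.2.1
      simp [hi] at this
      omega
    have hle := B.2.le_of_expo_ne_zero hB
    have hl0 : l ≠ 0 := by
      rintro rfl
      rw [leg_zero] at hlt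
      exact absurd (hlt.trans_le hle) (lt_irrefl _)
    obtain _ | p := p
    · exact hl0 (Subsingleton.elim (α := Fin 1) _ _)
    have := congrFun htail 0
    rw [Fin.succAbove_ne_zero_zero hl0, leg_zero] at this
    have h3 := A.2.lt_leg_succ 0
    rw [← this] at h3
    exact absurd (h3.trans_le hle) (lt_irrefl _)

theorem coeff_coeffPoly_of_ne {k : ℕ} {A B : Σ h : Fin k, Hook q p h} (hAB : A ≠ B) :
    (A.2.coeffPoly B.2.leg).coeff B.2.expo = 0 := by
  rw [coeffPoly, MvPolynomial.coeff_sum]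
  refine Finset.sum_eq_zero fun l _ => ?_
  rw [MvPolynomial.coeff_smul, smul_eq_mul]
  by_contra hc
  have h1 := left_ne_zero_of_mul hc
  exact hAB (eq_of_term_ne_zero (right_ne_zero_of_mul h1) (right_ne_zero_of_mul hc)).1

theorem coeff_coeffPoly_self {k : ℕ} (A : Σ h : Fin k, Hook q p h) :
    (A.2.coeffPoly A.2.leg).coeff A.2.expo ≠ 0 := by
  rw [coeffPoly, MvPolynomial.coeff_sum, Finset.sum_eq_single 0]
  · rw [MvPolynomial.coeff_smul, smul_eq_mul]
    have h1 : coordForm (fun i => A.2.leg i.succ)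
        (stdVec fun i => A.2.leg ((0 : Fin (p + 1)).succAbove i)) = 1 := by
      simp only [Fin.succAbove_zero]
      exact coordForm_stdVec_self fun i j hij => A.2.leg_strictMono (Fin.succ_lt_succ_iff.2 hij)
    rw [h1, leg_zero, MvPolynomial.pderiv_monomial, add_tsub_cancel_right,
      MvPolynomial.coeff_monomial, if_pos rfl]
    simp only [Fin.val_zero, pow_zero, one_mul, Finsupp.add_apply, Finsupp.single_eq_same]
    exact Nat.cast_ne_zero.2 (Nat.succ_ne_zero _)
  · intro l _ hl
    rw [MvPolynomial.coeff_smul, smul_eq_mul]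
    by_contra hc
    have h1 := left_ne_zero_of_mul hc
    exact hl (eq_of_term_ne_zero (right_ne_zero_of_mul h1) (right_ne_zero_of_mul hc)).2
  · exact fun h => absurd (Finset.mem_univ _) h

end Hook

/-- A polynomial that vanishes at `0` to an order greater than its degree is zero. -/
theorem polynomial_eq_zero_of_isBigO {P : Polynomial ℂ} {k : ℕ} (hP : P.natDegree ≤ k)
    (hO : (fun t => P.eval t) =O[𝓝 0] fun t => ‖t‖ ^ (k + 1)) : P = 0 := by
  by_contra hne
  obtain ⟨Q, hQ, hQ0⟩ := P.exists_eq_pow_rootMultiplicity_mul_and_not_dvd hne 0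
  set r := P.rootMultiplicity 0
  rw [map_zero, sub_zero] at hQ hQ0
  have hr : r ≤ k := by
    refine le_trans ?_ hP
    simpa using Polynomial.natDegree_le_of_dvd ⟨Q, hQ⟩ hne
  have hQz : Q.eval 0 ≠ 0 := by
    rwa [Ne, ← Polynomial.coeff_zero_eq_eval_zero, ← Polynomial.X_dvd_iff]
  have h1 : (fun t => Q.eval t) =O[𝓝[≠] 0] fun t : ℂ => ‖t‖ ^ (k + 1 - r) := by
    obtain ⟨C, hC⟩ := hO.bound
    refine Asymptotics.IsBigO.of_bound C ?_
    filter_upwards [nhdsWithin_le_nhds hC, self_mem_nhdsWithin] with t ht ht0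
    have htp : 0 < ‖t‖ ^ r := pow_pos (norm_pos_iff.2 ht0) r
    have e : ‖t‖ ^ (k + 1) = ‖t‖ ^ r * ‖t‖ ^ (k + 1 - r) := by
      rw [← pow_add]; congr 1; omega
    rw [hQ, Polynomial.eval_mul, Polynomial.eval_pow, Polynomial.eval_X, norm_mul, norm_pow,
      norm_pow, norm_norm, e] at ht
    rw [norm_pow, norm_norm]
    refine le_of_mul_le_mul_left ?_ htp
    linarith
  have h2 : Tendsto (fun t : ℂ => ‖t‖ ^ (k + 1 - r)) (𝓝[≠] 0) (𝓝 0) := by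
    have : Tendsto (fun t : ℂ => ‖t‖ ^ (k + 1 - r)) (𝓝 0) (𝓝 (‖(0 : ℂ)‖ ^ (k + 1 - r))) :=
      (continuous_norm.pow _).tendsto 0
    rw [norm_zero, zero_pow (by omega)] at this
    exact this.mono_left nhdsWithin_le_nhds
  have h3 := h1.trans_tendsto h2
  have h4 : Tendsto (fun t => Q.eval t) (𝓝[≠] 0) (𝓝 (Q.eval 0)) :=
    (Q.continuous.tendsto 0).mono_left nhdsWithin_le_nhds
  exact hQz (tendsto_nhds_unique h4 h3)

theorem mvPolynomial_eq_zero_of_isBigO {P : MvPolynomial (Fin q) ℂ} {k : ℕ}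
    (hP : P.totalDegree ≤ k) {x₀ : Amb q}
    (hO : (fun x => MvPolynomial.eval x P) =O[𝓝 x₀] fun x => ‖x - x₀‖ ^ (k + 1)) : P = 0 := by
  apply MvPolynomial.funext
  intro y
  -- restrict to the line through `x₀` and `y`
  let Q : Polynomial ℂ :=
    MvPolynomial.aeval (fun i => Polynomial.C (x₀ i) + Polynomial.X * Polynomial.C (y i - x₀ i)) P
  have hQ : ∀ t, Q.eval t = MvPolynomial.eval (x₀ + t • (y - x₀)) P := by
    intro t
    have := MvPolynomial.map_aeval (fun i => Polynomial.C (x₀ i) +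
      Polynomial.X * Polynomial.C (y i - x₀ i)) (Polynomial.evalRingHom t) P
    rw [Polynomial.coe_evalRingHom] at this
    refine this.trans (MvPolynomial.eval₂Hom_congr ?_ ?_ rfl)
    · ext a; simp
    · funext i; simp
  have hdeg : Q.natDegree ≤ k := by
    have h1 : ∀ i, (Polynomial.C (x₀ i) +
        Polynomial.X * Polynomial.C (y i - x₀ i)).natDegree ≤ 1 := fun i => by
      refine (Polynomial.natDegree_add_le _ _).trans (max_le ?_ ?_)
      · rw [Polynomial.natDegree_C]; exact Nat.zero_le _
      · exact (Polynomial.natDegree_mul_C_le _ _).trans Polynomial.natDegree_X_le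
    have h2 := MvPolynomial.aeval_natDegree_le P hP _ h1
    rwa [mul_one] at h2
  clear_value Q
  have ht : Tendsto (fun t : ℂ => x₀ + t • (y - x₀)) (𝓝 0) (𝓝 x₀) := by
    have : Continuous fun t : ℂ => x₀ + t • (y - x₀) := by fun_prop
    simpa using this.tendsto 0
  have hQ0 : Q = 0 := by
    refine polynomial_eq_zero_of_isBigO hdeg ?_
    have h1 := hO.comp_tendsto ht
    simp only [Function.comp_def, add_sub_cancel_left, ← hQ] at h1
    refine h1.trans (Asymptotics.IsBigO.of_bound (‖y - x₀‖ ^ (k + 1))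
      (Eventually.of_forall fun t => ?_))
    rw [norm_smul, mul_pow, norm_mul, norm_pow, norm_norm, norm_pow, norm_norm, mul_comm]
  have := hQ 1
  rw [hQ0] at this
  simpa using this.symm

/-- A linear combination of the closed forms of the hooks of degree at most `k` that vanishes to
order `k + 1` at one point is trivial. -/
theorem closedForm_coeff_eq_zero {p k : ℕ} {z₀ : Amb q}
    {c : (Σ h : Fin (k + 1), Hook q p h) → ℂ}
    (hO : (fun x => ∑ A, c A • A.2.closedForm x) =O[𝓝 z₀] fun x => ‖x - z₀‖ ^ (k + 1)) :
    c = 0 := by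
  funext B
  let P : MvPolynomial (Fin q) ℂ := ∑ A, c A • A.2.coeffPoly B.2.leg
  have hdeg : P.totalDegree ≤ k := by
    refine MvPolynomial.totalDegree_finsetSum_le fun A _ => ?_
    refine (MvPolynomial.totalDegree_smul_le _ _).trans ?_
    exact (A.2.totalDegree_coeffPoly_le _).trans (Nat.lt_succ_iff.1 A.1.2)
  have hP : P = 0 := by
    refine mvPolynomial_eq_zero_of_isBigO hdeg (x₀ := z₀) ?_
    let ev := ContinuousAlternatingMap.apply ℂ (Amb q) ℂ (stdVec B.2.leg)
    have h1 := (ev.isBigO_comp (fun x => ∑ A, c A • A.2.closedForm x) (𝓝 z₀)).trans hO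
    refine h1.congr_left fun x => ?_
    rw [map_sum, map_sum]
    refine Finset.sum_congr rfl fun A _ => ?_
    rw [map_smul, MvPolynomial.smul_eval, ← A.2.closedForm_stdVec]
    rfl
  have h2 : P.coeff B.2.expo = 0 := by rw [hP]; simp
  rw [MvPolynomial.coeff_sum, Finset.sum_eq_single B] at h2
  · rw [MvPolynomial.coeff_smul, smul_eq_mul] at h2
    exact (mul_eq_zero.1 h2).resolve_right (Hook.coeff_coeffPoly_self B)
  · intro A _ hAB
    rw [MvPolynomial.coeff_smul, Hook.coeff_coeffPoly_of_ne hAB, smul_zero]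
  · exact fun h => absurd (Finset.mem_univ _) h

end

/-! ### Pullbacks of closed forms and their jets -/

section

variable {n q : ℕ}

/-- The components of an alternating form in the standard basis. -/
def altValues (n p : ℕ) : Alt n p →ₗ[ℂ] ((Fin p → Fin n) → ℂ) where
  toFun a J := a (stdVec J)
  map_add' _ _ := rfl
  map_smul' _ _ := rfl

theorem altValues_injective (n p : ℕ) : Function.Injective (altValues n p) := by
  intro a b h
  apply ContinuousAlternatingMap.toAlternatingMap_injective
  refine Module.Basis.ext_alternating (Pi.basisFun ℂ (Fin n)) fun J _ => ?_
  have : (fun i => (Pi.basisFun ℂ (Fin n)) (J i)) = stdVec J := by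
    funext i; simp [stdVec, Pi.basisFun_apply]
  rw [this]
  exact congrFun h J

instance (p : ℕ) : FiniteDimensional ℂ (Alt n p) :=
  FiniteDimensional.of_injective _ (altValues_injective n p)

/-- The components of a tensor in the standard basis. -/
def tensorValues (n p k : ℕ) :
    ContinuousMultilinearMap ℂ (fun _ : Fin k => Amb n) (Alt n p) →ₗ[ℂ]
      ((Fin k → Fin n) → Alt n p) where
  toFun φ g := φ (stdVec g)
  map_add' _ _ := rfl
  map_smul' _ _ := rfl

theorem tensorValues_injective (n p k : ℕ) : Function.Injective (tensorValues n p k) := by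
  intro a b h
  apply ContinuousMultilinearMap.toMultilinearMap_injective
  refine Module.Basis.ext_multilinear (fun _ => Pi.basisFun ℂ (Fin n)) fun g => ?_
  have : (fun i => (Pi.basisFun ℂ (Fin n)) (g i)) = stdVec g := by
    funext i; simp [stdVec, Pi.basisFun_apply]
  rw [this]
  exact congrFun h g

instance (p k : ℕ) :
    FiniteDimensional ℂ (ContinuousMultilinearMap ℂ (fun _ : Fin k => Amb n) (Alt n p)) :=
  FiniteDimensional.of_injective _ (tensorValues_injective n p k)

/-- Analyticity of a form can be tested on its components. -/
theorem analyticAt_alt {p : ℕ} {f : Amb n → Alt n p} {x : Amb n}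
    (hf : ∀ v, AnalyticAt ℂ (fun y => f y v) x) : AnalyticAt ℂ f x := by
  obtain ⟨N, hN⟩ := (altValues n p).exists_leftInverse_of_injective
    (LinearMap.ker_eq_bot.2 (altValues_injective n p))
  have h1 : AnalyticAt ℂ (fun y J => f y (stdVec J) : Amb n → (Fin p → Fin n) → ℂ) x :=
    AnalyticAt.pi fun J => hf (stdVec J)
  have h2 := (LinearMap.toContinuousLinearMap N).analyticAt
    (fun J => f x (stdVec J) : (Fin p → Fin n) → ℂ) |>.comp h1
  have h3 : f = LinearMap.toContinuousLinearMap N ∘ (fun y J => f y (stdVec J)) := by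
    funext y
    exact (LinearMap.congr_fun hN (f y)).symm
  rw [h3]
  exact h2

theorem alt_apply_eq_sum {p : ℕ} (a : Alt q p) (w : Fin p → Amb q) :
    a w = ∑ J : Fin p → Fin q, (∏ i, w i (J i)) * a (stdVec J) := by
  have h1 : w = fun i => ∑ j, w i j • (Pi.single j 1 : Amb q) := by
    funext i
    exact pi_eq_sum_univ' (w i)
  conv_lhs => rw [h1]
  refine (a.toMultilinearMap.map_sum fun i j => w i j • (Pi.single j 1 : Amb q)).trans ?_
  refine Finset.sum_congr rfl fun J _ => ?_
  exact a.toMultilinearMap.map_smul_univ (fun i => w i (J i)) (stdVec J)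

/-- The pullback by `u` of the closed form of a hook. -/
def Hook.pullForm {p h : ℕ} (u : Amb n → Amb q) (A : Hook q p h) : Amb n → Alt n (p + 1) :=
  fun x => (A.closedForm (u x)).compContinuousLinearMap (fderiv ℂ u x)

theorem Hook.analyticAt_pullForm {p h : ℕ} {u : Amb n → Amb q} (A : Hook q p h) {x : Amb n}
    (hu : AnalyticAt ℂ u x) : AnalyticAt ℂ (A.pullForm u) x := by
  refine analyticAt_alt fun v => ?_
  have h1 : (fun y => A.pullForm u y v) = fun y => ∑ J : Fin (p + 1) → Fin q,
      (∏ i, fderiv ℂ u y (v i) (J i)) * A.closedForm (u y) (stdVec J) := by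
    funext y
    exact alt_apply_eq_sum (A.closedForm (u y)) fun i => fderiv ℂ u y (v i)
  rw [h1]
  refine Finset.analyticAt_fun_sum _ fun J _ => AnalyticAt.mul ?_ ?_
  · refine Finset.analyticAt_fun_prod _ fun i _ => ?_
    have := ((ContinuousLinearMap.proj (J i) : Amb q →L[ℂ] ℂ).comp
      (ContinuousLinearMap.apply ℂ (Amb q) (v i))).analyticAt (fderiv ℂ u x)
    exact this.comp hu.fderiv
  · have h2 := (ContinuousAlternatingMap.apply ℂ (Amb q) ℂ (stdVec J)).analyticAt
      (A.closedForm (u x))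
    exact AnalyticAt.comp (f := A.closedForm ∘ u) h2 ((A.analyticAt_closedForm (u x)).comp hu)

theorem Hook.extDeriv_pullForm {p h : ℕ} {u : Amb n → Amb q} (A : Hook q p h) {x : Amb n}
    (hu : AnalyticAt ℂ u x) : extDeriv (A.pullForm u) x = 0 := by
  have h1 := extDeriv_pullback (r := ⊤) (A.analyticAt_closedForm (u x)).differentiableAt
    hu.contDiffAt (by simp)
  refine h1.trans ?_
  rw [A.extDeriv_closedForm]
  rfl

theorem Hook.pullForm_mem_closedBasic {p h : ℕ} {u : Amb n → Amb q} (A : Hook q p h) {m : Amb n}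
    {T : Amb n → Submodule ℂ (Amb n)} (hu : AnalyticAt ℂ u m)
    (hT : ∀ᶠ y in 𝓝 m, T y = LinearMap.ker (fderiv ℂ u y : Amb n →ₗ[ℂ] Amb q)) :
    A.pullForm u ∈ closedBasic (p + 1) T m := by
  refine ⟨A.analyticAt_pullForm hu, ?_⟩
  filter_upwards [hT, hu.eventually_analyticAt] with y hy huy
  have h1 := A.extDeriv_pullForm huy
  refine ⟨fun v hv => ?_, fun v _ => by rw [h1]; rfl, h1⟩
  obtain ⟨j, hj⟩ := hv
  rw [hy, LinearMap.mem_ker] at hj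
  exact (A.closedForm (u y)).map_coord_zero j hj

/-- Forms whose pullback by a submersion vanishes to some order vanish to that order. -/
theorem isBigO_of_isBigO_pullback {p k : ℕ} {u : Amb n → Amb q} {m : Amb n}
    (hu : AnalyticAt ℂ u m) (hs : Function.Surjective (fderiv ℂ u m)) {η : Amb q → Alt q p}
    (hO : (fun x => (η (u x)).compContinuousLinearMap (fderiv ℂ u x)) =O[𝓝 m]
      fun x => ‖x - m‖ ^ k) :
    η =O[𝓝 (u m)] fun z => ‖z - u m‖ ^ k := by
  obtain ⟨S, hS, hS'⟩ := exists_rightInverse_field hu hs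
  have h1 : (fun x => η (u x)) =O[𝓝 m] fun x => ‖x - m‖ ^ k := by
    have h2 : (fun x => η (u x)) =O[𝓝 m] fun x =>
        ‖(η (u x)).compContinuousLinearMap (fderiv ℂ u x)‖ * ‖S x‖ ^ p := by
      refine Asymptotics.IsBigO.of_bound 1 ?_
      filter_upwards [hS'] with x hx
      have e : η (u x) = ((η (u x)).compContinuousLinearMap
          (fderiv ℂ u x)).compContinuousLinearMap (S x) := by
        ext w
        simp [Function.comp_def, hx]
      have := ContinuousAlternatingMap.norm_compContinuousLinearMap_le
        ((η (u x)).compContinuousLinearMap (fderiv ℂ u x)) (S x)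
      rw [← e, Fintype.card_fin] at this
      rw [one_mul, norm_mul, norm_norm, norm_pow, norm_norm]
      exact this
    have h3 : (fun x => ‖S x‖ ^ p) =O[𝓝 m] fun _ => (1 : ℝ) :=
      (hS.norm.pow p).tendsto.isBigO_one ℝ
    simpa using h2.trans (hO.norm_left.mul h3)
  -- a local section of `u` through `m`
  let R := S m
  have hR : ∀ x, fderiv ℂ u m (R x) = x := hS'.self_of_nhds
  let g : Amb q → Amb q := fun t => u (m + R t)
  have hg : HasStrictFDerivAt g
      ((ContinuousLinearEquiv.refl ℂ (Amb q) : Amb q ≃L[ℂ] Amb q) : Amb q →L[ℂ] Amb q) 0 := by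
    have e0 : m + R 0 = m := by simp
    have h4 : HasStrictFDerivAt u (fderiv ℂ u m) (m + R 0) := by
      rw [e0]; exact hu.hasStrictFDerivAt
    have h5 : HasStrictFDerivAt (fun t => m + R t) R 0 := (R.hasStrictFDerivAt).const_add m
    have h6 := h4.comp (0 : Amb q) h5
    refine h6.congr_fderiv ?_
    ext x : 1
    exact hR x
  have hg0 : g 0 = u m := by simp [g]
  set s := hg.localInverse g _ 0 with hsdef
  have hs0 : s (u m) = 0 := by rw [← hg0]; exact hg.localInverse_apply_image
  have hsd := hg.to_localInverse
  rw [← hsdef, hg0] at hsd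
  have hsO : s =O[𝓝 (u m)] fun z => z - u m := by
    simpa [hs0] using hsd.differentiableAt.isBigO_sub
  have hev : ∀ᶠ z in 𝓝 (u m), g (s z) = z := by
    have := hg.eventually_right_inverse
    rwa [hg0] at this
  have ht : Tendsto (fun z => m + R (s z)) (𝓝 (u m)) (𝓝 m) := by
    have : ContinuousAt (fun z => m + R (s z)) (u m) :=
      continuousAt_const.add (R.continuous.continuousAt.comp hsd.continuousAt)
    simpa [ContinuousAt, hs0] using this
  have h7 := h1.comp_tendsto ht
  refine (h7.congr' (hev.mono fun z hz => congrArg η hz) EventuallyEq.rfl).trans ?_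
  have h8 : (fun z => m + R (s z) - m) =O[𝓝 (u m)] fun z => z - u m := by
    simp only [add_sub_cancel_left]
    exact (R.isBigO_comp s _).trans hsO
  exact h8.norm_norm.pow k

/-- The derivative of order `h` at `m`, as a linear map on closed basic forms. -/
def derivMap (p : ℕ) (T : Amb n → Submodule ℂ (Amb n)) (m : Amb n) (h : ℕ) :
    closedBasic p T m →ₗ[ℂ] ContinuousMultilinearMap ℂ (fun _ : Fin h => Amb n) (Alt n p) where
  toFun ω := iteratedFDeriv ℂ h ω.1 m
  map_add' ω η := iteratedFDeriv_add_apply ω.2.1.contDiffAt η.2.1.contDiffAt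
  map_smul' _ ω := iteratedFDeriv_const_smul_apply ω.2.1.contDiffAt

/-- The `k`-jet at `m`, as a linear map on closed basic forms. -/
def jetMap (p k : ℕ) (T : Amb n → Submodule ℂ (Amb n)) (m : Amb n) :
    closedBasic p T m →ₗ[ℂ] Jet n p k :=
  LinearMap.pi fun h => derivMap p T m h

theorem jetMap_apply (p k : ℕ) (T : Amb n → Submodule ℂ (Amb n)) (m : Amb n)
    (ω : closedBasic p T m) : jetMap p k T m ω = jet k ω.1 m := rfl

theorem coe_sum_closedBasic {p : ℕ} {T : Amb n → Submodule ℂ (Amb n)} {m : Amb n} {ι : Type*}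
    [Fintype ι] (c : ι → ℂ) (ω : ι → closedBasic p T m) (x : Amb n) :
    (∑ a, c a • ω a : closedBasic p T m).1 x = ∑ a, c a • (ω a).1 x := by
  rw [Submodule.coe_sum, Finset.sum_apply]
  rfl

/-- The `k`-jets of the pullbacks by a submersion of the closed forms of the hooks of degree at
most `k` are linearly independent at every point. -/
theorem jet_pullForm_coeff_eq_zero {p k : ℕ} {u : Amb n → Amb q} {m : Amb n}
    (hu : AnalyticAt ℂ u m) (hs : Function.Surjective (fderiv ℂ u m))
    {c : (Σ h : Fin (k + 1), Hook q p h) → ℂ}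
    (hc : ∑ A, c A • jet k (A.2.pullForm u) m = 0) : c = 0 := by
  let T : Amb n → Submodule ℂ (Amb n) := fun y => LinearMap.ker (fderiv ℂ u y : Amb n →ₗ[ℂ] Amb q)
  let ω : (Σ h : Fin (k + 1), Hook q p h) → closedBasic (p + 1) T m := fun A =>
    ⟨A.2.pullForm u, A.2.pullForm_mem_closedBasic hu (Eventually.of_forall fun _ => rfl)⟩
  have h1 : jetMap (p + 1) k T m (∑ A, c A • ω A) = 0 := by
    rw [map_sum, ← hc]
    exact Finset.sum_congr rfl fun A _ => map_smul _ _ _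
  have h2 : ∀ j < k + 1, iteratedFDeriv ℂ j (∑ A, c A • ω A : closedBasic (p + 1) T m).1 m = 0 :=
    fun j hj => congrFun h1 ⟨j, hj⟩
  have h3 := isBigO_pow_of_iteratedFDeriv_eq_zero (∑ A, c A • ω A).2.1 h2
  refine closedForm_coeff_eq_zero (z₀ := u m) (isBigO_of_isBigO_pullback hu hs ?_)
  refine h3.congr_left fun x => ?_
  rw [coe_sum_closedBasic]
  ext v
  simp [ω, Hook.pullForm]

theorem analyticAt_jet_pullForm {p k h : ℕ} {u : Amb n → Amb q} {m : Amb n} (A : Hook q p h)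
    (hu : AnalyticAt ℂ u m) : AnalyticAt ℂ (fun y => jet k (A.pullForm u) y) m := by
  refine AnalyticAt.pi fun j => ?_
  have h1 : AnalyticOnNhd ℂ (A.pullForm u) {x | AnalyticAt ℂ u x} :=
    fun x hx => A.analyticAt_pullForm hx
  exact h1.iteratedFDeriv j m hu

end

/-! ### Dimension counts and analytic frames -/

section

/-- Dimension count along a filtration: if the vectors on which `l 0, …, l (h - 1)` vanish are sent
into `D h` by `l h`, and `ρ` vanishes on the common kernel of `l 0, …, l (N - 1)`, then the rank
of `ρ` is at most the sum of the dimensions of `D 0, …, D (N - 1)`. -/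
theorem finrank_range_le_of_filtration {K V : Type*} [Field K] [AddCommGroup V] [Module K V]
    {X : ℕ → Type*} [∀ h, AddCommGroup (X h)] [∀ h, Module K (X h)]
    (l : ∀ h, V →ₗ[K] X h) (D : ∀ h, Submodule K (X h)) (hfin : ∀ h, Module.Finite K (D h))
    (N : ℕ)
    (hD : ∀ h < N, ∀ v, (∀ j < h, l j v = 0) → l h v ∈ D h)
    {Y : Type*} [AddCommGroup Y] [Module K Y] (ρ : V →ₗ[K] Y)
    (hρ : ∀ v, (∀ j < N, l j v = 0) → ρ v = 0) :
    FiniteDimensional K (LinearMap.range ρ) ∧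
      Module.finrank K (LinearMap.range ρ) ≤ ∑ h ∈ Finset.range N, Module.finrank K (D h) := by
  induction N generalizing Y with
  | zero =>
    have : ρ = 0 := by ext v; exact hρ v fun j hj => absurd hj (Nat.not_lt_zero j)
    subst this
    rw [LinearMap.range_zero]
    exact ⟨inferInstance, by simp⟩
  | succ N ih =>
    -- `D N` bounds `ρ` on the common kernel `VN` of the first `N` maps, and the induction hypothesis
    -- bounds `ρ` modulo the image of `VN`
    let VN : Submodule K V := ⨅ j : Fin N, LinearMap.ker (l j)
    have hVN : ∀ v ∈ VN, ∀ j < N, l j v = 0 := fun v hv j hj =>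
      (Submodule.mem_iInf _).1 hv ⟨j, hj⟩
    let lN : VN →ₗ[K] D N := ((l N).domRestrict VN).codRestrict (D N) fun v =>
      hD N (Nat.lt_succ_self N) v (hVN v v.2)
    let ρN : VN →ₗ[K] Y := ρ.domRestrict VN
    have hker : LinearMap.ker lN ≤ LinearMap.ker ρN := by
      intro v hv
      refine hρ v fun j hj => ?_
      rcases Nat.lt_succ_iff_lt_or_eq.1 hj with h | rfl
      · exact hVN v v.2 j h
      · exact congrArg Subtype.val hv
    have e1 : FiniteDimensional K (VN ⧸ LinearMap.ker lN) :=
      Module.Finite.equiv lN.quotKerEquivRange.symm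
    let σ : (VN ⧸ LinearMap.ker lN) →ₗ[K] Y := (LinearMap.ker lN).liftQ ρN hker
    have hσ : LinearMap.range σ = LinearMap.range ρN := Submodule.range_liftQ _ _ _
    have f1 : FiniteDimensional K (LinearMap.range ρN) := by
      rw [← hσ]; infer_instance
    have f2 : Module.finrank K (LinearMap.range ρN) ≤ Module.finrank K (D N) := by
      rw [← hσ]
      refine (LinearMap.finrank_range_le σ).trans ?_
      rw [lN.quotKerEquivRange.finrank_eq]
      exact Submodule.finrank_le _
    obtain ⟨g1, g2⟩ := ih (fun h hh => hD h (hh.trans (Nat.lt_succ_self N)))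
      ((LinearMap.range ρN).mkQ.comp ρ) (fun v hv => by
        rw [LinearMap.comp_apply, Submodule.mkQ_apply, Submodule.Quotient.mk_eq_zero]
        exact ⟨⟨v, (Submodule.mem_iInf _).2 fun j => hv j j.2⟩, rfl⟩)
    -- the range of `ρ` is an extension of that of its reduction modulo `range ρN`
    let π : LinearMap.range ρ →ₗ[K] LinearMap.range ((LinearMap.range ρN).mkQ.comp ρ) :=
      ((LinearMap.range ρN).mkQ.domRestrict (LinearMap.range ρ)).codRestrict _ (by
        rintro ⟨_, v, rfl⟩; exact ⟨v, rfl⟩)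
    have hπ : ∀ y ∈ LinearMap.ker π, (y : Y) ∈ LinearMap.range ρN := by
      intro y hy
      have := congrArg Subtype.val hy
      exact (Submodule.Quotient.mk_eq_zero _).1 this
    let ι : LinearMap.ker π →ₗ[K] LinearMap.range ρN :=
      ((LinearMap.range ρ).subtype.domRestrict (LinearMap.ker π)).codRestrict _ fun y => hπ y y.2
    have hι : Function.Injective ι := fun a b hab =>
      Subtype.ext (Subtype.ext (congrArg Subtype.val hab : (ι a : Y) = ι b))
    have k1 : FiniteDimensional K (LinearMap.ker π) := FiniteDimensional.of_injective ι hι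
    have k2 := LinearMap.finrank_le_finrank_of_injective hι
    have fin : FiniteDimensional K (LinearMap.range ρ) := by
      have q1 : FiniteDimensional K (LinearMap.range ρ ⧸ LinearMap.ker π) :=
        Module.Finite.equiv π.quotKerEquivRange.symm
      exact Module.Finite.of_submodule_quotient (LinearMap.ker π)
    refine ⟨fin, ?_⟩
    have k3 := π.finrank_range_add_finrank_ker
    have k4 := Submodule.finrank_le (LinearMap.range π)
    rw [Finset.sum_range_succ]
    omega

/-- The kernels of an analytic family of linear maps form an analytic bundle if their dimension is
constant. The frame is `G(y)⁻¹ b`, with `b` a basis of the kernel at `x`, where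
`G(y) = N M(y) + (1 - N M(x))` for a generalized inverse `N` of `M(x)`: then `G(x) = 1`, and `G(y)`
maps `ker M(y)` into `ker M(x)`. -/
theorem exists_analytic_frame_ker {E V J : Type*} [NormedAddCommGroup E] [NormedSpace ℂ E]
    [NormedAddCommGroup V] [NormedSpace ℂ V] [FiniteDimensional ℂ V]
    [NormedAddCommGroup J] [NormedSpace ℂ J] [FiniteDimensional ℂ J]
    {W : Set E} (hW : IsOpen W) {M : E → V →L[ℂ] J} (hM : AnalyticOnNhd ℂ M W) {r : ℕ}
    (hr : ∀ y ∈ W, Module.finrank ℂ (LinearMap.ker (M y : V →ₗ[ℂ] J)) = r) {x : E} (hx : x ∈ W) :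
    ∃ W' : Set E, IsOpen W' ∧ x ∈ W' ∧ W' ⊆ W ∧ ∃ s : Fin r → E → V,
      (∀ j, AnalyticOnNhd ℂ (s j) W') ∧ ∀ y ∈ W', LinearIndependent ℂ (fun j => s j y) ∧
        Submodule.span ℂ (Set.range fun j => s j y) = LinearMap.ker (M y : V →ₗ[ℂ] J) := by
  have : CompleteSpace V := FiniteDimensional.complete ℂ V
  obtain ⟨N, hN⟩ : ∃ N : J →L[ℂ] V, ∀ v, M x (N (M x v)) = M x v := by
    obtain ⟨N₀, hN₀⟩ := (M x : V →ₗ[ℂ] J).rangeRestrict.exists_rightInverse_of_surjective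
      (LinearMap.range_rangeRestrict _)
    obtain ⟨N₁, hN₁⟩ := N₀.exists_extend
    refine ⟨LinearMap.toContinuousLinearMap N₁, fun v => ?_⟩
    have h1 : N₁ (M x v) = N₀ ((M x : V →ₗ[ℂ] J).rangeRestrict v) :=
      LinearMap.congr_fun hN₁ ((M x : V →ₗ[ℂ] J).rangeRestrict v)
    have h2 := LinearMap.congr_fun hN₀ ((M x : V →ₗ[ℂ] J).rangeRestrict v)
    have h3 : (LinearMap.toContinuousLinearMap N₁) (M x v) = N₁ (M x v) := rfl
    rw [h3, h1]
    exact congrArg Subtype.val h2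
  let P : V →L[ℂ] V := 1 - N.comp (M x)
  have hP : ∀ v, P v ∈ LinearMap.ker (M x : V →ₗ[ℂ] J) := by
    intro v
    rw [LinearMap.mem_ker]
    change M x (v - N (M x v)) = 0
    rw [map_sub, hN, sub_self]
  let G : E → V →L[ℂ] V := fun y => N.comp (M y) + P
  have hG : AnalyticOnNhd ℂ G W := fun y hy =>
    (((ContinuousLinearMap.compL ℂ V J V N).analyticAt (M y)).comp (hM y hy)).add analyticAt_const
  have hGx : G x = 1 := by
    change N.comp (M x) + (1 - N.comp (M x)) = 1
    abel
  let W' := W ∩ G ⁻¹' {A | IsUnit A}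
  have hker : ∀ y, ∀ v ∈ LinearMap.ker (M y : V →ₗ[ℂ] J), G y v = P v := by
    intro y v hv
    change N (M y v) + P v = P v
    have : M y v = 0 := hv
    rw [this, map_zero, zero_add]
  let b := Module.finBasisOfFinrankEq ℂ (LinearMap.ker (M x : V →ₗ[ℂ] J)) (hr x hx)
  refine ⟨W', hG.continuousOn.isOpen_inter_preimage hW Units.isOpen,
    ⟨hx, by rw [Set.mem_preimage, hGx]; exact isUnit_one⟩, Set.inter_subset_left,
    fun j y => Ring.inverse (G y) (b j), fun j y hy => ?_, fun y hy => ?_⟩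
  · obtain ⟨U, hU⟩ : IsUnit (G y) := hy.2
    have h1 : AnalyticAt ℂ Ring.inverse (G y) := by
      rw [← hU]; exact analyticAt_inverse U
    exact ((ContinuousLinearMap.apply ℂ V (b j : V)).analyticAt _).comp (h1.comp (hG y hy.1))
  · have hu : IsUnit (G y) := hy.2
    have hleft : ∀ v, Ring.inverse (G y) (G y v) = v := fun v =>
      DFunLike.congr_fun (Ring.inverse_mul_cancel (G y) hu) v
    have hright : ∀ v, G y (Ring.inverse (G y) v) = v := fun v =>
      DFunLike.congr_fun (Ring.mul_inverse_cancel (G y) hu) v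
    let H : LinearMap.ker (M x : V →ₗ[ℂ] J) →ₗ[ℂ] V :=
      ((Ring.inverse (G y) : V →L[ℂ] V) : V →ₗ[ℂ] V).comp (Submodule.subtype _)
    have hH : Function.Injective H := by
      intro v w hvw
      apply Subtype.ext
      have := congrArg (G y) hvw
      rwa [show H v = Ring.inverse (G y) v from rfl, show H w = Ring.inverse (G y) w from rfl,
        hright, hright] at this
    have hli : LinearIndependent ℂ fun j => Ring.inverse (G y) (b j : V) :=
      b.linearIndependent.map' H (LinearMap.ker_eq_bot.2 hH)
    refine ⟨hli, ?_⟩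
    have hspan : Submodule.span ℂ (Set.range fun j => Ring.inverse (G y) (b j : V)) =
        LinearMap.range H := by
      have : (fun j => Ring.inverse (G y) (b j : V)) = H ∘ b := rfl
      rw [this, Set.range_comp, Submodule.span_image, b.span_eq, Submodule.map_top]
    symm
    refine Submodule.eq_of_le_of_finrank_eq ?_ ?_
    · intro v hv
      rw [hspan]
      refine ⟨⟨P v, hP v⟩, ?_⟩
      change Ring.inverse (G y) (P v) = v
      rw [← hker y v hv, hleft]
    · rw [hr y hy.1, finrank_span_eq_card hli, Fintype.card_fin]

/-- Analyticity of a family of operators on a finite-dimensional space can be tested on vectors. -/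
theorem analyticAt_clm_of_apply {E V J : Type*} [NormedAddCommGroup E] [NormedSpace ℂ E]
    [NormedAddCommGroup V] [NormedSpace ℂ V] [FiniteDimensional ℂ V]
    [NormedAddCommGroup J] [NormedSpace ℂ J] {M : E → V →L[ℂ] J} {x : E}
    (h : ∀ v, AnalyticAt ℂ (fun y => M y v) x) : AnalyticAt ℂ M x := by
  let b := Module.finBasis ℂ V
  have h1 : M = fun y => ∑ a, ContinuousLinearMap.smulRightL ℂ V J
      (LinearMap.toContinuousLinearMap (b.coord a)) (M y (b a)) := by
    funext y
    ext v
    conv_lhs => rw [← b.sum_repr v, map_sum]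
    simp
  rw [h1]
  exact Finset.analyticAt_fun_sum _ fun a _ =>
    ((ContinuousLinearMap.smulRightL ℂ V J
      (LinearMap.toContinuousLinearMap (b.coord a))).analyticAt _).comp (h (b a))

/-- A family of subspaces that an analytic family of injective linear maps `Φ y` parametrizes by the
kernels of an analytic family `M y` has analytic frames if its dimension is constant. -/
theorem exists_analytic_frame_map_ker {E C J V : Type*} [NormedAddCommGroup E] [NormedSpace ℂ E]
    [NormedAddCommGroup C] [NormedSpace ℂ C] [FiniteDimensional ℂ C]
    [NormedAddCommGroup J] [NormedSpace ℂ J] (hJ : Module.Finite ℂ J)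
    [NormedAddCommGroup V] [NormedSpace ℂ V] {R : E → Submodule ℂ V}
    {W : Set E} (hW : IsOpen W) {M : E → C →ₗ[ℂ] J} {Φ : E → C →ₗ[ℂ] V}
    (hM : ∀ c, AnalyticOnNhd ℂ (fun y => M y c) W) (hΦ : ∀ c, AnalyticOnNhd ℂ (fun y => Φ y c) W)
    (hinj : ∀ y ∈ W, Function.Injective (Φ y))
    (hR : ∀ y ∈ W, (LinearMap.ker (M y)).map (Φ y) = R y) {r : ℕ}
    (hr : ∀ y ∈ W, Module.finrank ℂ (LinearMap.ker (M y)) = r) {x : E} (hx : x ∈ W) :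
    ∃ W' : Set E, IsOpen W' ∧ x ∈ W' ∧ W' ⊆ W ∧ ∃ s : Fin r → E → V,
      (∀ j, AnalyticOnNhd ℂ (s j) W') ∧ ∀ y ∈ W', LinearIndependent ℂ (fun j => s j y) ∧
        Submodule.span ℂ (Set.range fun j => s j y) = R y := by
  have hM' : AnalyticOnNhd ℂ (fun y => LinearMap.toContinuousLinearMap (M y)) W :=
    fun y hy => analyticAt_clm_of_apply fun c => hM c y hy
  obtain ⟨W', hW', hxW', hsub, s, hs, hs'⟩ := exists_analytic_frame_ker hW hM' hr hx
  refine ⟨W', hW', hxW', hsub, fun j y => Φ y (s j y), fun j y hy => ?_, fun y hy => ?_⟩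
  · let b := Module.finBasis ℂ C
    have h1 : (fun y => Φ y (s j y)) = fun y => ∑ a,
        LinearMap.toContinuousLinearMap (b.coord a) (s j y) • Φ y (b a) := by
      funext y
      conv_lhs => rw [← b.sum_repr (s j y), map_sum]
      simp
    change AnalyticAt ℂ (fun y => Φ y (s j y)) y
    rw [h1]
    exact Finset.analyticAt_fun_sum _ fun a _ =>
      (((LinearMap.toContinuousLinearMap (b.coord a)).analyticAt _).comp (hs j y hy)).smul
        (hΦ (b a) y (hsub hy))
  · obtain ⟨h1, h2⟩ := hs' y hy
    refine ⟨h1.map' (Φ y) (LinearMap.ker_eq_bot.2 (hinj y (hsub hy))), ?_⟩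
    have h3 : (fun j => Φ y (s j y)) = Φ y ∘ fun j => s j y := rfl
    rw [h3, Set.range_comp, Submodule.span_image, h2]
    exact hR y (hsub hy)

/-- The same for families of subspaces described by their elements, and linear maps described as
functions: no module structures beyond the normed ones have to be matched when it is applied. -/
theorem exists_analytic_frame_of_forall_mem_iff {E C J V : Type*} [NormedAddCommGroup E]
    [NormedSpace ℂ E] [NormedAddCommGroup C] [NormedSpace ℂ C] [FiniteDimensional ℂ C]
    [NormedAddCommGroup J] [NormedSpace ℂ J] (hJ : Module.Finite ℂ J)
    [NormedAddCommGroup V] [NormedSpace ℂ V] {R : E → Submodule ℂ V} {K : E → Submodule ℂ C}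
    {W : Set E} (hW : IsOpen W) {M : E → C → J} {Φ : E → C → V}
    (hM : ∀ c, AnalyticOnNhd ℂ (fun y => M y c) W) (hΦ : ∀ c, AnalyticOnNhd ℂ (fun y => Φ y c) W)
    (hMa : ∀ y a b, M y (a + b) = M y a + M y b) (hMs : ∀ y (t : ℂ) a, M y (t • a) = t • M y a)
    (hΦa : ∀ y a b, Φ y (a + b) = Φ y a + Φ y b) (hΦs : ∀ y (t : ℂ) a, Φ y (t • a) = t • Φ y a)
    (hinj : ∀ y ∈ W, Function.Injective (Φ y)) (hK : ∀ y c, c ∈ K y ↔ M y c = 0)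
    (hR : ∀ y ∈ W, ∀ v, v ∈ R y ↔ ∃ c ∈ K y, Φ y c = v) {r : ℕ}
    (hr : ∀ y ∈ W, Module.finrank ℂ (K y) = r) {x : E} (hx : x ∈ W) :
    ∃ W' : Set E, IsOpen W' ∧ x ∈ W' ∧ W' ⊆ W ∧ ∃ s : Fin r → E → V,
      (∀ j, AnalyticOnNhd ℂ (s j) W') ∧ ∀ y ∈ W', LinearIndependent ℂ (fun j => s j y) ∧
        Submodule.span ℂ (Set.range fun j => s j y) = R y := by
  let M' : E → C →ₗ[ℂ] J := fun y => ⟨⟨M y, hMa y⟩, hMs y⟩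
  have hKM : ∀ y, LinearMap.ker (M' y) = K y := fun y => Submodule.ext fun c => (hK y c).symm
  refine exists_analytic_frame_map_ker hJ hW (M := M') (Φ := fun y => ⟨⟨Φ y, hΦa y⟩, hΦs y⟩) hM hΦ
    hinj (fun y hy => Submodule.ext fun v => ?_) (fun y hy => by rw [hKM]; exact hr y hy) hx
  rw [hKM]
  exact (hR y hy v).symm

end

section

/-- If the bound of `finrank_range_le_of_filtration` is attained by linearly independent vectors,
then these vectors span everything modulo the common kernel. -/
theorem exists_sum_smul_eq_of_filtration {K V : Type*} [Field K] [AddCommGroup V] [Module K V]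
    {X : ℕ → Type*} [∀ h, AddCommGroup (X h)] [∀ h, Module K (X h)]
    (l : ∀ h, V →ₗ[K] X h) (D : ∀ h, Submodule K (X h)) (hfin : ∀ h, Module.Finite K (D h))
    (N : ℕ)
    (hD : ∀ h < N, ∀ v, (∀ j < h, l j v = 0) → l h v ∈ D h) {B : Type*} [Fintype B] (e : B → V)
    (hB : ∑ h ∈ Finset.range N, Module.finrank K (D h) ≤ Fintype.card B)
    (he : ∀ c : B → K, (∀ j < N, l j (∑ A, c A • e A) = 0) → c = 0) (v : V) :
    ∃ c : B → K, ∀ j < N, l j v = l j (∑ A, c A • e A) := by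
  let ρ : V →ₗ[K] ((h : Fin N) → X h) := LinearMap.pi fun h => l h
  obtain ⟨h1, h2⟩ := finrank_range_le_of_filtration l D hfin N hD ρ
    (fun w hw => funext fun h => hw h h.2)
  let σ : (B → K) →ₗ[K] V := Fintype.linearCombination K e
  have hinj : Function.Injective (ρ.comp σ) := by
    refine LinearMap.ker_eq_bot.1 (LinearMap.ker_eq_bot'.2 fun c hc => he c fun j hj => ?_)
    exact congrFun hc ⟨j, hj⟩
  have hle : LinearMap.range (ρ.comp σ) ≤ LinearMap.range ρ := LinearMap.range_comp_le_range _ _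
  have heq : LinearMap.range (ρ.comp σ) = LinearMap.range ρ := by
    refine Submodule.eq_of_le_of_finrank_le hle ?_
    rw [LinearMap.finrank_range_of_inj hinj, Module.finrank_pi]
    exact h2.trans hB
  obtain ⟨c, hc⟩ : ρ v ∈ LinearMap.range (ρ.comp σ) := heq ▸ ⟨v, rfl⟩
  exact ⟨c, fun j hj => (congrFun hc ⟨j, hj⟩).symm⟩

/-- A linear map whose values are combinations of `card B` vectors has rank at most `card B`. -/
theorem finrank_le_finrank_ker_add_card {C J B : Type*} [AddCommGroup C] [Module ℂ C]
    [FiniteDimensional ℂ C] [iJ : AddCommMonoid J] [Module ℂ J] [Fintype B] (M : C →ₗ[ℂ] J)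
    (g : B → J) (h : ∀ c, ∃ b : B → ℂ, M c = ∑ A, b A • g A) :
    Module.finrank ℂ C ≤ Module.finrank ℂ (LinearMap.ker M) + Fintype.card B := by
  let _ : AddCommGroup J :=
    { Module.addCommMonoidToAddCommGroup ℂ with toAddCommMonoid := iJ }
  have hle : LinearMap.range M ≤ LinearMap.range (Fintype.linearCombination ℂ g) := by
    rintro _ ⟨c, rfl⟩
    obtain ⟨b, hb⟩ := h c
    exact ⟨b, hb.symm⟩
  have h1 := (Submodule.finrank_mono hle).trans
    (LinearMap.finrank_range_le (Fintype.linearCombination ℂ g))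
  rw [Module.finrank_pi] at h1
  have h2 := M.finrank_range_add_finrank_ker
  omega

/-- The families of vectors of the subspaces `S i` with sum zero. -/
def relations {K X : Type*} [Field K] [AddCommGroup X] [Module K X] {d : ℕ}
    (S : Fin d → Submodule K X) : Submodule K (Fin d → X) where
  carrier := {φ | (∀ i, φ i ∈ S i) ∧ ∑ i, φ i = 0}
  zero_mem' := ⟨fun i => (S i).zero_mem, Finset.sum_const_zero⟩
  add_mem' := by
    rintro a b ⟨ha, ha'⟩ ⟨hb, hb'⟩
    refine ⟨fun i => (S i).add_mem (ha i) (hb i), ?_⟩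
    simp [Finset.sum_add_distrib, ha', hb']
  smul_mem' := by
    rintro t a ⟨ha, ha'⟩
    refine ⟨fun i => (S i).smul_mem t (ha i), ?_⟩
    simp [← Finset.smul_sum, ha']

/-- The relations between subspaces embed into the kernel of the map `τ` that adds up their elements. -/
theorem finrank_relations {K X : Type*} [Field K] [AddCommGroup X] [Module K X] {d : ℕ}
    (S : Fin d → Submodule K X) (hfin : ∀ i, Module.Finite K (S i)) {S₀ : Submodule K X}
    (τ : ((i : Fin d) → S i) →ₗ[K] S₀) (hτ : ∀ w, (τ w : X) = ∑ i, (w i : X)) :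
    Module.Finite K (relations S) ∧
      Module.finrank K (relations S) + Module.finrank K (LinearMap.range τ) ≤
        ∑ i, Module.finrank K (S i) := by
  let ι : relations S →ₗ[K] LinearMap.ker τ :=
    { toFun := fun φ => ⟨fun i => ⟨φ.1 i, φ.2.1 i⟩, by
        rw [LinearMap.mem_ker]
        refine Subtype.ext ?_
        exact (hτ _).trans φ.2.2⟩
      map_add' := fun _ _ => rfl
      map_smul' := fun _ _ => rfl }
  have hι : Function.Injective ι := fun a b h => by
    refine Subtype.ext (funext fun i => ?_)
    exact congrArg (fun x : LinearMap.ker τ => ((x.1 i : S i) : X)) h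
  refine ⟨FiniteDimensional.of_injective ι hι, ?_⟩
  have h1 := LinearMap.finrank_le_finrank_of_injective hι
  have h2 := τ.finrank_range_add_finrank_ker
  rw [Module.finrank_pi_fintype] at h2
  omega

/-- Dimension count for families of vectors with sum zero: the dimension of the relations between
subspaces `S h i` of `S₀ h` is governed by the rank of the map that adds up their elements. The
spaces are only assumed to be additive monoids, the structure found on spaces of tensors. -/
theorem finrank_range_le_of_filtration_sum {V : Type*} [iV : AddCommMonoid V] [Module ℂ V]
    {X : ℕ → Type*} [iX : ∀ h, AddCommMonoid (X h)] [∀ h, Module ℂ (X h)] {d : ℕ}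
    (l : ∀ h, Fin d → V →ₗ[ℂ] X h) (S : ∀ h, Fin d → Submodule ℂ (X h))
    (hfin : ∀ h i, Module.Finite ℂ (S h i)) {S₀ : ∀ h, Submodule ℂ (X h)}
    (τ : ∀ h, ((i : Fin d) → S h i) →ₗ[ℂ] S₀ h) (hτ : ∀ h w, (τ h w : X h) = ∑ i, (w i : X h))
    (r : ℕ → ℕ) (hr : ∀ h, ∑ i, Module.finrank ℂ (S h i) ≤
      r h + Module.finrank ℂ (LinearMap.range (τ h))) (N : ℕ)
    (hS : ∀ h < N, ∀ v, (∀ j < h, ∀ i, l j i v = 0) → ∀ i, l h i v ∈ S h i)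
    (hsum : ∀ h < N, ∀ v, ∑ i, l h i v = 0) {Y : Type*} [iY : AddCommMonoid Y] [Module ℂ Y]
    (ρ : V →ₗ[ℂ] Y) (hρ : ∀ v, (∀ j < N, ∀ i, l j i v = 0) → ρ v = 0) :
    Module.Finite ℂ (LinearMap.range ρ) ∧ Module.finrank ℂ (LinearMap.range ρ) ≤
      ∑ h ∈ Finset.range N, r h := by
  let _ : AddCommGroup V := { Module.addCommMonoidToAddCommGroup ℂ with toAddCommMonoid := iV }
  let _ : AddCommGroup Y := { Module.addCommMonoidToAddCommGroup ℂ with toAddCommMonoid := iY }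
  let _ : ∀ h, AddCommGroup (X h) := fun h =>
    { Module.addCommMonoidToAddCommGroup ℂ with toAddCommMonoid := iX h }
  have h0 := fun h => finrank_relations (S h) (hfin h) (τ h) (hτ h)
  obtain ⟨h1, h2⟩ := finrank_range_le_of_filtration (fun h => LinearMap.pi (l h))
    (fun h => relations (S h)) (fun h => (h0 h).1) N
    (fun h hh v hv => ⟨hS h hh v fun j hj i => congrFun (hv j hj) i, hsum h hh v⟩) ρ
    fun v hv => hρ v fun j hj i => congrFun (hv j hj) i
  refine ⟨h1, h2.trans (Finset.sum_le_sum fun h _ => ?_)⟩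
  have h3 := (h0 h).2.trans (hr h)
  omega

/-- If the map that adds up elements of the subspaces `S i` has full rank, then there is no relation
between them. -/
theorem eq_zero_of_sum_eq_zero {X : Type*} [iX : AddCommMonoid X] [Module ℂ X] {d : ℕ}
    (S : Fin d → Submodule ℂ X) (hfin : ∀ i, Module.Finite ℂ (S i)) {S₀ : Submodule ℂ X}
    (τ : ((i : Fin d) → S i) →ₗ[ℂ] S₀) (hτ : ∀ w, (τ w : X) = ∑ i, (w i : X))
    (hr : ∑ i, Module.finrank ℂ (S i) ≤ Module.finrank ℂ (LinearMap.range τ)) {w : Fin d → X}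
    (hw : ∀ i, w i ∈ S i) (hsum : ∑ i, w i = 0) (i : Fin d) : w i = 0 := by
  let _ : AddCommGroup X :=
    { Module.addCommMonoidToAddCommGroup ℂ with toAddCommMonoid := iX }
  obtain ⟨h1, h2⟩ := finrank_relations S hfin τ hτ
  have h3 : Module.finrank ℂ (relations S) = 0 := by omega
  have h4 : w ∈ relations S := ⟨hw, hsum⟩
  rw [Submodule.finrank_eq_zero.1 h3] at h4
  exact congrFun ((Submodule.mem_bot ℂ).1 h4) i

end

/-! ### Jets of closed basic forms of a foliation -/

section

variable {n q d : ℕ}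

/-- Near `m`, the distribution `T` is tangent to the fibres of the holomorphic map `u`, which is a
submersion at `m`. -/
structure IsLocalSubmersion (u : Amb n → Amb q) (T : Amb n → Submodule ℂ (Amb n)) (m : Amb n) :
    Prop where
  analyticAt : AnalyticAt ℂ u m
  surjective : Function.Surjective (fderiv ℂ u m)
  eventually_eq_ker : ∀ᶠ y in 𝓝 m, T y = LinearMap.ker (fderiv ℂ u y : Amb n →ₗ[ℂ] Amb q)

/-- The foliation by points, whose closed basic forms are all closed forms. -/
theorem isLocalSubmersion_id (m : Amb n) :
    IsLocalSubmersion (fun x : Amb n => x) (fun _ => ⊥) m := by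
  have h : ∀ y : Amb n, fderiv ℂ (fun x : Amb n => x) y = ContinuousLinearMap.id ℂ _ := fun y =>
    fderiv_fun_id
  refine ⟨analyticAt_id, ?_, Eventually.of_forall fun y => ?_⟩
  · rw [h]; exact Function.surjective_id
  · rw [h]; exact LinearMap.ker_id.symm

theorem Foliation.exists_isLocalSubmersion {U : Set (Amb n)} (F : Foliation n q U) {x : Amb n}
    (hx : x ∈ U) : ∃ W : Set (Amb n), IsOpen W ∧ x ∈ W ∧ W ⊆ U ∧ ∃ u : Amb n → Amb q,
      ∀ y ∈ W, IsLocalSubmersion u F.T y := by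
  obtain ⟨W, hW, hxW, hWU, u, hu, h⟩ := F.exists_submersion x hx
  refine ⟨W, hW, hxW, hWU, u, fun y hy => ⟨hu y hy, (h y hy).1, ?_⟩⟩
  filter_upwards [hW.mem_nhds hy] with z hz using (h z hz).2

theorem IsLocalSubmersion.finrank_symbol_le {u : Amb n → Amb q} {T : Amb n → Submodule ℂ (Amb n)}
    {m : Amb n} (hu : IsLocalSubmersion u T m) (p h : ℕ) :
    Module.finrank ℂ (symbol (p + 1) h (T m)) ≤ Fintype.card (Hook q p h) := by
  rw [hu.eventually_eq_ker.self_of_nhds]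
  exact finrank_symbol_ker_le p h _ hu.surjective

theorem card_sigma_hook (q p k : ℕ) : Fintype.card (Σ h : Fin (k + 1), Hook q p h) =
    ∑ h ∈ Finset.range (k + 1), Fintype.card (Hook q p h) := by
  rw [Fintype.card_sigma, Fin.sum_univ_eq_sum_range fun h => Fintype.card (Hook q p h)]

/-- The `k`-jets of the pullbacks of the closed forms of the hooks span the `k`-jets of closed basic
forms: they are independent, and there are as many as the symbols allow. -/
theorem exists_jet_eq_sum {u : Amb n → Amb q} {T : Amb n → Submodule ℂ (Amb n)}
    {m : Amb n} (hu : IsLocalSubmersion u T m) {p k : ℕ} {ω : Amb n → Alt n (p + 1)}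
    (hω : ω ∈ closedBasic (p + 1) T m) : ∃ c : (Σ h : Fin (k + 1), Hook q p h) → ℂ,
      jet k ω m = ∑ A, c A • jet k (A.2.pullForm u) m := by
  have key : ∀ c : (Σ h : Fin (k + 1), Hook q p h) → ℂ,
      jetMap (p + 1) k T m (∑ A, c A • ⟨A.2.pullForm u,
        A.2.pullForm_mem_closedBasic hu.analyticAt hu.eventually_eq_ker⟩) =
      ∑ A, c A • jet k (A.2.pullForm u) m := fun c => by
    rw [map_sum]
    exact Finset.sum_congr rfl fun A _ => map_smul _ _ _
  obtain ⟨c, hc⟩ := exists_sum_smul_eq_of_filtration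
    (X := fun h => ContinuousMultilinearMap ℂ (fun _ : Fin h => Amb n) (Alt n (p + 1)))
    (derivMap (p + 1) T m) (fun h => symbol (p + 1) h (T m)) (fun h => inferInstance) (k + 1)
    (fun h _ ω hω => iteratedFDeriv_mem_symbol hu.analyticAt hu.surjective hu.eventually_eq_ker
      (Subtype.property ω) hω) (fun A : (Σ h : Fin (k + 1), Hook q p h) => ⟨A.2.pullForm u,
        A.2.pullForm_mem_closedBasic hu.analyticAt hu.eventually_eq_ker⟩)
    (by rw [card_sigma_hook]; exact Finset.sum_le_sum fun h _ => hu.finrank_symbol_le p h)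
    (fun c hc => jet_pullForm_coeff_eq_zero hu.analyticAt hu.surjective
      ((key c).symm.trans (funext fun h => hc h h.2))) ⟨ω, hω⟩
  exact ⟨c, Eq.trans (funext fun h => hc h h.2) (key c)⟩

end

/-! ### Frames and ranks of symbols -/

section

variable {n q d : ℕ}

/-- The linear combinations of the `k`-jets of the pullbacks of the closed forms of the hooks. -/
def frameMap (p k : ℕ) (u : Amb n → Amb q) (m : Amb n) :
    ((Σ h : Fin (k + 1), Hook q p h) → ℂ) →ₗ[ℂ] Jet n (p + 1) k :=
  Fintype.linearCombination ℂ fun A => jet k (A.2.pullForm u) m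

theorem exists_mem_closedBasic_jet_eq_frameMap {u : Amb n → Amb q}
    {T : Amb n → Submodule ℂ (Amb n)} {m : Amb n} (hu : IsLocalSubmersion u T m) (p k : ℕ)
    (c : (Σ h : Fin (k + 1), Hook q p h) → ℂ) :
    ∃ ω ∈ closedBasic (p + 1) T m, jet k ω m = frameMap p k u m c := by
  refine ⟨_, (∑ A, c A • ⟨A.2.pullForm u, A.2.pullForm_mem_closedBasic hu.analyticAt
    hu.eventually_eq_ker⟩ : closedBasic (p + 1) T m).2, ?_⟩
  rw [← jetMap_apply, map_sum]
  exact Finset.sum_congr rfl fun A _ => map_smul _ _ _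

/-- Only the source needs subtraction, so that no additive group structure on a space of jets enters. -/
theorem injective_of_forall_eq_zero {K C J : Type*} [Field K] [AddCommGroup C] [Module K C]
    [AddCommMonoid J] [Module K J] {f : C →ₗ[K] J} (hf : ∀ c, f c = 0 → c = 0) :
    Function.Injective f := by
  intro a b hab
  refine sub_eq_zero.1 (hf _ ?_)
  rw [sub_eq_add_neg, map_add, hab, ← map_add, add_neg_cancel, map_zero]

theorem frameMap_injective {p k : ℕ} {u : Amb n → Amb q} {T : Amb n → Submodule ℂ (Amb n)}
    {m : Amb n} (hu : IsLocalSubmersion u T m) : Function.Injective (frameMap p k u m) :=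
  injective_of_forall_eq_zero fun _ hc =>
    jet_pullForm_coeff_eq_zero hu.analyticAt hu.surjective hc

theorem analyticAt_sum_smul {E J B : Type*} [NormedAddCommGroup E] [NormedSpace ℂ E]
    [NormedAddCommGroup J] [NormedSpace ℂ J] [Fintype B] (c : B → ℂ) {f : B → E → J} {x : E}
    (hf : ∀ A, AnalyticAt ℂ (f A) x) : AnalyticAt ℂ (fun y => ∑ A, c A • f A y) x :=
  Finset.analyticAt_fun_sum _ fun A _ => (hf A).const_smul (c := c A)

theorem analyticAt_frameMap {p k : ℕ} {u : Amb n → Amb q} {T : Amb n → Submodule ℂ (Amb n)}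
    {m : Amb n} (hu : IsLocalSubmersion u T m) (c : (Σ h : Fin (k + 1), Hook q p h) → ℂ) :
    AnalyticAt ℂ (fun y => frameMap p k u y c) m := by
  have h1 : ∀ y, frameMap p k u y c = ∑ A, c A • jet k (A.2.pullForm u) y := fun y => rfl
  simp only [h1]
  exact analyticAt_sum_smul c fun A => analyticAt_jet_pullForm A.2 hu.analyticAt

/-- The dimension of the relations of degree `h` between the symbols of an ordinary web. -/
def relDim (n d q p h : ℕ) : ℕ := d * Fintype.card (Hook q p h) - Fintype.card (Hook n p h)

theorem coe_traceSymbol_apply (p k : ℕ) (S : Fin d → Submodule ℂ (Amb n))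
    (w : (i : Fin d) → symbol p k (S i)) : (traceSymbol p k S w).1 = ∑ i, (w i).1 := by
  rw [traceSymbol, LinearMap.sum_apply, Submodule.coe_sum]
  rfl

/-- The rank condition on `traceSymbol` bounds the relations between the symbols by `relDim`. -/
theorem sum_finrank_symbol_le (hq : 1 ≤ q) (hn : 1 ≤ n) {p h : ℕ} {u : Fin d → Amb n → Amb q}
    {T : Fin d → Amb n → Submodule ℂ (Amb n)} {m : Amb n}
    (hu : ∀ i, IsLocalSubmersion (u i) (T i) m)
    (hord : (Module.finrank ℂ (LinearMap.range (traceSymbol (p + 1) h fun i => T i m)) : ℤ) =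
      min (z n (p + 1) h) (d * z q (p + 1) h)) :
    ∑ i, Module.finrank ℂ (symbol (p + 1) h (T i m)) ≤ relDim n d q p h +
      Module.finrank ℂ (LinearMap.range (traceSymbol (p + 1) h fun i => T i m)) := by
  have h3 : ∑ i, Module.finrank ℂ (symbol (p + 1) h (T i m)) ≤ d * Fintype.card (Hook q p h) := by
    refine (Finset.sum_le_sum fun i _ => (hu i).finrank_symbol_le p h).trans ?_
    simp
  rw [← card_hook n p h hn, ← card_hook q p h hq] at hord
  have h4 : Module.finrank ℂ (LinearMap.range (traceSymbol (p + 1) h fun i => T i m)) =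
    min (Fintype.card (Hook n p h)) (d * Fintype.card (Hook q p h)) := by exact_mod_cast hord
  rw [h4]
  unfold relDim
  omega

end

/-! ### Formal abelian relations -/

section

variable {n q d : ℕ}

/-- The derivatives of order `h` of closed basic forms `ω i` with sum zero to order `h`, all of whose
lower derivatives vanish, are a relation between symbols; hence the dimension of a space of such
families is bounded by those of the spaces of relations between symbols. -/
theorem finrank_range_le_sum_relDim (hq : 1 ≤ q) (hn : 1 ≤ n) {p : ℕ} {u : Fin d → Amb n → Amb q}
    {T : Fin d → Amb n → Submodule ℂ (Amb n)} {m : Amb n}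
    (hu : ∀ i, IsLocalSubmersion (u i) (T i) m)
    (hord : ∀ h, (Module.finrank ℂ (LinearMap.range (traceSymbol (p + 1) h fun i => T i m)) : ℤ) =
      min (z n (p + 1) h) (d * z q (p + 1) h)) (N : ℕ) {V Y : Type*} [AddCommMonoid V] [Module ℂ V]
    [AddCommMonoid Y] [Module ℂ Y] (v : (i : Fin d) → V →ₗ[ℂ] closedBasic (p + 1) (T i) m)
    (hv : ∀ x, ∀ h < N, ∑ i, iteratedFDeriv ℂ h (v i x).1 m = 0) (ρ : V →ₗ[ℂ] Y)
    (hρ : ∀ x, (∀ h < N, ∀ i, iteratedFDeriv ℂ h (v i x).1 m = 0) → ρ x = 0) :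
    Module.Finite ℂ (LinearMap.range ρ) ∧
      Module.finrank ℂ (LinearMap.range ρ) ≤ ∑ h ∈ Finset.range N, relDim n d q p h := by
  exact finrank_range_le_of_filtration_sum
    (X := fun h => ContinuousMultilinearMap ℂ (fun _ : Fin h => Amb n) (Alt n (p + 1)))
    (fun h i => (derivMap (p + 1) (T i) m h).comp (v i)) (fun h i => symbol (p + 1) h (T i m))
    (fun h i => inferInstance) (fun h => traceSymbol (p + 1) h fun i => T i m)
    (fun h => coe_traceSymbol_apply (p + 1) h fun i => T i m) (relDim n d q p)
    (fun h => sum_finrank_symbol_le hq hn hu (hord h)) N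
    (fun h hh x hx i => iteratedFDeriv_mem_symbol (hu i).analyticAt (hu i).surjective
      (hu i).eventually_eq_ker (v i x).2 fun j hj => hx j hj i) (fun h hh x => hv x h hh) ρ
    (fun x hx => hρ x fun h hh i => hx h hh i)

/-- Basic forms of any foliation are basic for the foliation by points, so that forms of different
foliations can be added there. -/
theorem closedBasic_le_bot {p : ℕ} (T : Amb n → Submodule ℂ (Amb n)) (m : Amb n) :
    closedBasic p T m ≤ closedBasic p (fun _ => ⊥) m := by
  rintro ω ⟨h1, h2⟩
  refine ⟨h1, ?_⟩
  filter_upwards [h2] with y hy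
  refine ⟨fun v ⟨j, hj⟩ => ?_, fun v ⟨j, hj⟩ => ?_, hy.2.2⟩
  · exact (ω y).map_coord_zero j ((Submodule.mem_bot ℂ).1 hj)
  · exact (extDeriv ω y).map_coord_zero j ((Submodule.mem_bot ℂ).1 hj)

/-- The sum of the jets given by their coordinates in the frames of the foliations. -/
def frameSum (p k : ℕ) (u : Fin d → Amb n → Amb q) (m : Amb n) :
    (Fin d → (Σ h : Fin (k + 1), Hook q p h) → ℂ) →ₗ[ℂ] Jet n (p + 1) k :=
  ∑ i, (frameMap p k (u i) m).comp (LinearMap.proj i)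

theorem frameSum_apply (p k : ℕ) (u : Fin d → Amb n → Amb q) (m : Amb n)
    (c : Fin d → (Σ h : Fin (k + 1), Hook q p h) → ℂ) :
    frameSum p k u m c = ∑ i, frameMap p k (u i) m (c i) := by
  rw [frameSum, LinearMap.sum_apply]
  rfl

/-- The family of the jets given by their coordinates in the frames of the foliations. -/
def framePi (p k : ℕ) (u : Fin d → Amb n → Amb q) (m : Amb n) :
    (Fin d → (Σ h : Fin (k + 1), Hook q p h) → ℂ) →ₗ[ℂ] (Fin d → Jet n (p + 1) k) :=
  LinearMap.pi fun i => (frameMap p k (u i) m).comp (LinearMap.proj i)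

/-- In the frames of the foliations, the formal abelian relations are the kernel of `frameSum`. -/
theorem map_ker_frameSum {p k : ℕ} {u : Fin d → Amb n → Amb q}
    {T : Fin d → Amb n → Submodule ℂ (Amb n)} {m : Amb n}
    (hu : ∀ i, IsLocalSubmersion (u i) (T i) m) :
    (LinearMap.ker (frameSum p k u m)).map (framePi p k u m) = formalRel (p + 1) k T m := by
  ext a
  constructor
  · rintro ⟨c, hc, rfl⟩
    refine ⟨fun i => exists_mem_closedBasic_jet_eq_frameMap (hu i) p k (c i), ?_⟩
    exact (frameSum_apply p k u m c).symm.trans hc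
  · rintro ⟨ha, ha'⟩
    have h1 : ∀ i, ∃ c, frameMap p k (u i) m c = a i := fun i => by
      obtain ⟨ω, hω, e⟩ := ha i
      obtain ⟨c, hc⟩ := exists_jet_eq_sum (k := k) (hu i) hω
      exact ⟨c, hc.symm.trans e⟩
    choose c hc using h1
    have h2 : framePi p k u m c = a := funext hc
    refine ⟨c, ?_, h2⟩
    refine (frameSum_apply p k u m c).trans ?_
    simp only [hc]
    exact ha'

/-- A sum of jets of closed basic forms is the jet of a closed form, hence a combination of the frame of
the foliation by points. This bounds the number of equations for a formal abelian relation. -/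
theorem exists_frameSum_eq {p k : ℕ} {u : Fin d → Amb n → Amb q}
    {T : Fin d → Amb n → Submodule ℂ (Amb n)} {m : Amb n}
    (hu : ∀ i, IsLocalSubmersion (u i) (T i) m)
    (c : Fin d → (Σ h : Fin (k + 1), Hook q p h) → ℂ) :
    ∃ b : (Σ h : Fin (k + 1), Hook n p h) → ℂ,
      frameSum p k u m c = ∑ A, b A • jet k (A.2.pullForm fun x : Amb n => x) m := by
  choose ω hω e using fun i => exists_mem_closedBasic_jet_eq_frameMap (hu i) p k (c i)
  let η : Fin d → closedBasic (p + 1) (fun _ : Amb n => ⊥) m := fun i =>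
    ⟨ω i, closedBasic_le_bot (T i) m (hω i)⟩
  obtain ⟨b, hb⟩ := exists_jet_eq_sum (k := k) (isLocalSubmersion_id m) (∑ i, η i).2
  refine ⟨b, Eq.trans ?_ hb⟩
  rw [frameSum_apply, ← jetMap_apply, map_sum]
  exact Finset.sum_congr rfl fun i _ => (e i).symm

end

section

variable {n q d : ℕ}

/-- The relations between the frames have the dimension that the ranks of the symbols predict: the
symbols bound it from above, the number of equations from below. -/
theorem finrank_ker_frameSum (hq : 1 ≤ q) (hn : 1 ≤ n) {p k : ℕ} {u : Fin d → Amb n → Amb q}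
    {T : Fin d → Amb n → Submodule ℂ (Amb n)} {m : Amb n}
    (hu : ∀ i, IsLocalSubmersion (u i) (T i) m)
    (hord : ∀ h, (Module.finrank ℂ (LinearMap.range (traceSymbol (p + 1) h fun i => T i m)) : ℤ) =
      min (z n (p + 1) h) (d * z q (p + 1) h))
    (hk : ∀ h ≤ k, Fintype.card (Hook n p h) ≤ d * Fintype.card (Hook q p h)) :
    Module.finrank ℂ (LinearMap.ker (frameSum p k u m)) =
      ∑ h ∈ Finset.range (k + 1), relDim n d q p h := by
  refine le_antisymm ?_ ?_
  · let σ : ∀ i, ((Σ h : Fin (k + 1), Hook q p h) → ℂ) →ₗ[ℂ] closedBasic (p + 1) (T i) m := fun i =>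
      Fintype.linearCombination ℂ fun A => ⟨A.2.pullForm (u i),
        A.2.pullForm_mem_closedBasic (hu i).analyticAt (hu i).eventually_eq_ker⟩
    have hσ : ∀ i c, jetMap (p + 1) k (T i) m (σ i c) = frameMap p k (u i) m c := fun i c => by
      refine (map_sum _ _ _).trans ?_
      exact Finset.sum_congr rfl fun A _ => map_smul _ _ _
    have h1 := (finrank_range_le_sum_relDim hq hn hu hord (k + 1)
      (fun i => (σ i).comp ((LinearMap.proj i).comp (LinearMap.ker (frameSum p k u m)).subtype))
      (fun x h hh => ?_) (LinearMap.ker (frameSum p k u m)).subtype fun x hx => ?_).2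
    · rwa [LinearMap.finrank_range_of_inj (Submodule.injective_subtype _)] at h1
    · have h2 : ∑ i, jetMap (p + 1) k (T i) m (σ i (x.1 i)) = 0 := by
        simp only [hσ]
        exact (frameSum_apply p k u m x.1).symm.trans x.2
      have h3 := congrFun h2 ⟨h, hh⟩
      rw [Finset.sum_apply] at h3
      exact h3
    · refine funext fun i => frameMap_injective (hu i) (k := k) (p := p) ?_
      rw [← hσ]
      refine Eq.trans (funext fun h => hx h.1 h.2 i) (map_zero (frameMap p k (u i) m)).symm
  · have h1 := finrank_le_finrank_ker_add_card (frameSum p k u m) _ (exists_frameSum_eq hu)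
    rw [Module.finrank_pi_fintype, card_sigma_hook] at h1
    simp only [Module.finrank_pi, card_sigma_hook, Finset.sum_const, Finset.card_univ,
      Fintype.card_fin, smul_eq_mul] at h1
    have h2 : ∑ h ∈ Finset.range (k + 1), relDim n d q p h +
        ∑ h ∈ Finset.range (k + 1), Fintype.card (Hook n p h) =
        d * ∑ h ∈ Finset.range (k + 1), Fintype.card (Hook q p h) := by
      rw [← Finset.sum_add_distrib, Finset.mul_sum]
      refine Finset.sum_congr rfl fun h hh => ?_
      have := hk h (Nat.lt_succ_iff.1 (Finset.mem_range.1 hh))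
      unfold relDim
      omega
    omega

end

section

variable {n q d : ℕ}

theorem analyticAt_sum_of_forall {E J B : Type*} [NormedAddCommGroup E] [NormedSpace ℂ E]
    [NormedAddCommGroup J] [NormedSpace ℂ J] [Fintype B] {f : B → E → J} {x : E}
    (hf : ∀ A, AnalyticAt ℂ (f A) x) : AnalyticAt ℂ (fun y => ∑ A, f A y) x :=
  Finset.analyticAt_fun_sum _ fun A _ => hf A

theorem analyticAt_frameSum {p k : ℕ} {u : Fin d → Amb n → Amb q}
    {T : Fin d → Amb n → Submodule ℂ (Amb n)} {m : Amb n}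
    (hu : ∀ i, IsLocalSubmersion (u i) (T i) m)
    (c : Fin d → (Σ h : Fin (k + 1), Hook q p h) → ℂ) :
    AnalyticAt ℂ (fun y => frameSum p k u y c) m := by
  simp only [frameSum_apply]
  exact analyticAt_sum_of_forall fun i => analyticAt_frameMap (hu i) (c i)

theorem analyticAt_framePi {p k : ℕ} {u : Fin d → Amb n → Amb q}
    {T : Fin d → Amb n → Submodule ℂ (Amb n)} {m : Amb n}
    (hu : ∀ i, IsLocalSubmersion (u i) (T i) m)
    (c : Fin d → (Σ h : Fin (k + 1), Hook q p h) → ℂ) :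
    AnalyticAt ℂ (fun y => framePi p k u y c) m :=
  AnalyticAt.pi fun i => analyticAt_frameMap (hu i) (c i)

theorem framePi_injective {p k : ℕ} {u : Fin d → Amb n → Amb q}
    {T : Fin d → Amb n → Submodule ℂ (Amb n)} {m : Amb n}
    (hu : ∀ i, IsLocalSubmersion (u i) (T i) m) : Function.Injective (framePi p k u m) :=
  fun _ _ hab => funext fun i => frameMap_injective (hu i) (congrFun hab i)

/-- In the frames, the formal abelian relations are the kernels of an analytic family of linear maps,
of constant dimension by `finrank_ker_frameSum`. -/
theorem isHolomorphicSubbundle_formalRel (hq : 1 ≤ q) (hn : 1 ≤ n) {p k : ℕ} {U : Set (Amb n)}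
    (hU : IsOpen U) (F : Fin d → Foliation n q U)
    (hord : StronglyOrdinary q (p + 1) U fun i => (F i).T)
    (hk : ∀ h ≤ k, Fintype.card (Hook n p h) ≤ d * Fintype.card (Hook q p h)) :
    IsHolomorphicSubbundle (V := Fin d → Jet n (p + 1) k) U
      (formalRel (p + 1) k fun i => (F i).T) (∑ h ∈ Finset.range (k + 1), relDim n d q p h) := by
  intro x hx
  choose W hW hxW hWU u hu using fun i => (F i).exists_isLocalSubmersion hx
  have hloc : ∀ y ∈ U ∩ ⋂ i, W i, ∀ i, IsLocalSubmersion (u i) (F i).T y := fun y hy i =>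
    hu i y (Set.mem_iInter.1 hy.2 i)
  have hR : ∀ y ∈ U ∩ ⋂ i, W i, ∀ v, v ∈ formalRel (p + 1) k (fun i => (F i).T) y ↔
      ∃ c ∈ LinearMap.ker (frameSum p k u y), framePi p k u y c = v := fun y hy v => by
    rw [← map_ker_frameSum (hloc y hy)]
    exact Submodule.mem_map
  have hJ : Module.Finite ℂ (Jet n (p + 1) k) := inferInstance
  have hr : ∀ y ∈ U ∩ ⋂ i, W i, Module.finrank ℂ (LinearMap.ker (frameSum p k u y)) =
      ∑ h ∈ Finset.range (k + 1), relDim n d q p h := fun y hy =>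
    finrank_ker_frameSum hq hn (hloc y hy) (hord y hy.1) hk
  have hW' : IsOpen (U ∩ ⋂ i, W i) := hU.inter (isOpen_iInter_of_finite hW)
  have hM : ∀ c, AnalyticOnNhd ℂ (fun y => frameSum p k u y c) (U ∩ ⋂ i, W i) :=
    fun c y hy => analyticAt_frameSum (hloc y hy) c
  have hΦ : ∀ c, AnalyticOnNhd ℂ (fun y => framePi p k u y c) (U ∩ ⋂ i, W i) :=
    fun c y hy => analyticAt_framePi (hloc y hy) c
  have hinj : ∀ y ∈ U ∩ ⋂ i, W i, Function.Injective (framePi p k u y) :=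
    fun y hy => framePi_injective (hloc y hy)
  have hMa : ∀ y a b, frameSum p k u y (a + b) = frameSum p k u y a + frameSum p k u y b :=
    fun y => map_add (frameSum p k u y)
  have hMs : ∀ y (t : ℂ) a, frameSum p k u y (t • a) = t • frameSum p k u y a :=
    fun y => map_smul (frameSum p k u y)
  have hΦa : ∀ y a b, framePi p k u y (a + b) = framePi p k u y a + framePi p k u y b :=
    fun y => map_add (framePi p k u y)
  have hΦs : ∀ y (t : ℂ) a, framePi p k u y (t • a) = t • framePi p k u y a :=
    fun y => map_smul (framePi p k u y)
  have key := exists_analytic_frame_of_forall_mem_iff (J := Jet n (p + 1) k)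
    (V := Fin d → Jet n (p + 1) k) (E := Amb n) hJ (R := formalRel (p + 1) k fun i => (F i).T)
    (K := fun y => LinearMap.ker (frameSum p k u y)) (W := U ∩ ⋂ i, W i) hW'
    (M := fun y c => frameSum p k u y c) (Φ := fun y c => framePi p k u y c)
    hM hΦ hMa hMs hΦa hΦs hinj (fun y c => Iff.rfl) hR hr (x := x) ⟨hx, Set.mem_iInter.2 hxW⟩
  obtain ⟨W', h1, h2, h3, h4⟩ := key
  exact ⟨W', h1, h2, h3.trans Set.inter_subset_left, h4⟩

end

/-! ### Germs of abelian relations -/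

section

variable {n q d : ℕ}

/-- An analytic function with vanishing Taylor coefficients vanishes near the point. -/
theorem eventuallyEq_zero_of_iteratedFDeriv_eq_zero {E G : Type*} [NormedAddCommGroup E]
    [NormedSpace ℂ E] [NormedAddCommGroup G] [NormedSpace ℂ G] [CompleteSpace G] {f : E → G}
    {x : E} (hf : AnalyticAt ℂ f x) (h0 : ∀ h, iteratedFDeriv ℂ h f x = 0) : f =ᶠ[𝓝 x] 0 := by
  obtain ⟨P, r, hP⟩ := hf
  filter_upwards [Metric.eball_mem_nhds x hP.r_pos] with y hy
  have h1 : y - x ∈ Metric.eball (0 : E) r := by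
    rw [Metric.mem_eball, edist_eq_enorm_sub] at hy ⊢
    simpa using hy
  have h2 := hP.hasSum_iteratedFDeriv h1
  simp only [h0] at h2
  rw [add_sub_cancel] at h2
  exact (h2.unique (by simp)).trans rfl

/-- The germ at `m` of a closed basic form. -/
def germMap (p : ℕ) (T : Amb n → Submodule ℂ (Amb n)) (m : Amb n) :
    closedBasic p T m →ₗ[ℂ] Germ (𝓝 m) (Alt n p) where
  toFun ω := (ω.1 : Germ (𝓝 m) (Alt n p))
  map_add' _ _ := rfl
  map_smul' _ _ := rfl

/-- The families of closed basic forms with sum zero near `m`. -/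
def formRel (p : ℕ) (T : Fin d → Amb n → Submodule ℂ (Amb n)) (m : Amb n) :
    Submodule ℂ ((i : Fin d) → closedBasic p (T i) m) :=
  LinearMap.ker (∑ i, (germMap p (T i) m).comp (LinearMap.proj i))

theorem sum_germ_eq_zero {p : ℕ} {T : Fin d → Amb n → Submodule ℂ (Amb n)} {m : Amb n}
    {ω : (i : Fin d) → closedBasic p (T i) m} (hω : ω ∈ formRel p T m) :
    ∑ i, ((ω i).1 : Germ (𝓝 m) (Alt n p)) = 0 := by
  have h1 := LinearMap.mem_ker.1 hω
  rw [LinearMap.sum_apply] at h1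
  exact h1

theorem sum_iteratedFDeriv_eq_zero {p : ℕ} {T : Fin d → Amb n → Submodule ℂ (Amb n)} {m : Amb n}
    {ω : (i : Fin d) → closedBasic p (T i) m} (hω : ω ∈ formRel p T m) (h : ℕ) :
    ∑ i, iteratedFDeriv ℂ h (ω i).1 m = 0 := by
  let η : Fin d → closedBasic p (fun _ : Amb n => ⊥) m := fun i =>
    ⟨(ω i).1, closedBasic_le_bot (T i) m (ω i).2⟩
  have h1 : germMap p (fun _ => ⊥) m (∑ i, η i) = 0 := by
    rw [map_sum]
    have h2 := sum_germ_eq_zero hω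
    exact h2
  have h2 : (∑ i, η i).1 =ᶠ[𝓝 m] fun _ => 0 := Germ.coe_eq.1 h1
  have h3 : derivMap p (fun _ => ⊥) m h (∑ i, η i) = 0 := by
    refine (h2.iteratedFDeriv ℂ h).self_of_nhds.trans ?_
    simp
  rw [map_sum] at h3
  exact h3

/-- From the order on at which the symbols have no relations, the derivatives of an abelian
relation are determined by those of lower order. -/
theorem iteratedFDeriv_eq_zero_of_relDim_eq_zero (hq : 1 ≤ q) (hn : 1 ≤ n) {p : ℕ}
    {u : Fin d → Amb n → Amb q} {T : Fin d → Amb n → Submodule ℂ (Amb n)} {m : Amb n}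
    (hu : ∀ i, IsLocalSubmersion (u i) (T i) m)
    (hord : ∀ h, (Module.finrank ℂ (LinearMap.range (traceSymbol (p + 1) h fun i => T i m)) : ℤ) =
      min (z n (p + 1) h) (d * z q (p + 1) h)) {N : ℕ} (hN : ∀ h, N ≤ h → relDim n d q p h = 0)
    {ω : (i : Fin d) → closedBasic (p + 1) (T i) m} (hω : ω ∈ formRel (p + 1) T m)
    (h0 : ∀ h < N, ∀ i, iteratedFDeriv ℂ h (ω i).1 m = 0) (h : ℕ) (i : Fin d) :
    iteratedFDeriv ℂ h (ω i).1 m = 0 := by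
  induction h using Nat.strong_induction_on generalizing i with
  | _ h ih =>
    rcases lt_or_ge h N with hh | hh
    · exact h0 h hh i
    · have h1 := sum_finrank_symbol_le hq hn hu (hord h)
      rw [hN h hh, zero_add] at h1
      exact eq_zero_of_sum_eq_zero (fun i => symbol (p + 1) h (T i m)) (fun i => inferInstance)
        (traceSymbol (p + 1) h fun i => T i m) (coe_traceSymbol_apply (p + 1) h fun i => T i m) h1
        (w := fun i => iteratedFDeriv ℂ h (ω i).1 m)
        (fun i => iteratedFDeriv_mem_symbol (hu i).analyticAt (hu i).surjective
          (hu i).eventually_eq_ker (ω i).2 fun j hj => ih j hj i)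
        (sum_iteratedFDeriv_eq_zero hω h) i

/-- A germ of an abelian relation is determined by its derivatives of order less than `N`, and these are
bounded by the relations between symbols. -/
theorem finrank_germRel_le (hq : 1 ≤ q) (hn : 1 ≤ n) {p : ℕ}
    {u : Fin d → Amb n → Amb q} {T : Fin d → Amb n → Submodule ℂ (Amb n)} {m : Amb n}
    (hu : ∀ i, IsLocalSubmersion (u i) (T i) m)
    (hord : ∀ h, (Module.finrank ℂ (LinearMap.range (traceSymbol (p + 1) h fun i => T i m)) : ℤ) =
      min (z n (p + 1) h) (d * z q (p + 1) h)) {N : ℕ} (hN : ∀ h, N ≤ h → relDim n d q p h = 0) :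
    Cardinal.toENat (Module.rank ℂ (germRel (p + 1) T m)) ≤
      (∑ h ∈ Finset.range N, relDim n d q p h : ℕ) := by
  let ρ : formRel (p + 1) T m →ₗ[ℂ] (Fin d → Germ (𝓝 m) (Alt n (p + 1))) :=
    LinearMap.pi fun i => (germMap (p + 1) (T i) m).comp
      ((LinearMap.proj i).comp (formRel (p + 1) T m).subtype)
  obtain ⟨h1, h2⟩ := finrank_range_le_sum_relDim hq hn hu hord N
    (fun i => (LinearMap.proj i).comp (formRel (p + 1) T m).subtype)
    (V := formRel (p + 1) T m) (fun x h _ => sum_iteratedFDeriv_eq_zero x.2 h) ρ fun x hx => funext fun i =>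
      Germ.coe_eq.2 (eventuallyEq_zero_of_iteratedFDeriv_eq_zero (x.1 i).2.1
        fun h => iteratedFDeriv_eq_zero_of_relDim_eq_zero hq hn hu hord hN x.2 hx h i)
  have hle : germRel (p + 1) T m ≤ LinearMap.range ρ := by
    rintro g ⟨hg, hg'⟩
    choose ω hω e using hg
    refine ⟨⟨fun i => ⟨ω i, hω i⟩, ?_⟩, funext e⟩
    rw [formRel, LinearMap.mem_ker, LinearMap.sum_apply, ← hg']
    exact Finset.sum_congr rfl fun i _ => e i
  refine (OrderHomClass.mono Cardinal.toENat (Submodule.rank_mono hle)).trans ?_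
  rw [← Module.finrank_eq_rank, Cardinal.toENat_nat]
  exact_mod_cast h2

end

/-! ### The numerical conclusion -/

section

variable {n q d p : ℕ}

theorem ratio_eq_card (hp : p + 1 ≤ q) (hqn : q < n) (h : ℕ) :
    ratio n q (p + 1) h = (Fintype.card (Hook n p h) : ℝ) / Fintype.card (Hook q p h) := by
  rw [ratio, ← card_hook n p h (by omega), ← card_hook q p h (by omega), Int.cast_natCast,
    Int.cast_natCast]

theorem card_hook_pos (hp : p + 1 ≤ q) (h : ℕ) : 0 < Fintype.card (Hook q p h) := by
  have h1 := z_pos (n := q) (p := p + 1) h (by omega) hp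
  rw [← card_hook q p h (by omega)] at h1
  exact_mod_cast h1

theorem ratio_le_iff (hp : p + 1 ≤ q) (hqn : q < n) (h : ℕ) :
    ratio n q (p + 1) h ≤ (d : ℝ) ↔ Fintype.card (Hook n p h) ≤ d * Fintype.card (Hook q p h) := by
  have h1 : (0 : ℝ) < Fintype.card (Hook q p h) := by exact_mod_cast card_hook_pos hp h
  rw [ratio_eq_card hp hqn, div_le_iff₀ h1]
  exact_mod_cast Iff.rfl

theorem relDim_eq (hp : p + 1 ≤ q) (hqn : q < n) {h : ℕ} (hd : ratio n q (p + 1) h ≤ (d : ℝ)) :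
    (relDim n d q p h : ℝ) = (z q (p + 1) h : ℝ) * ((d : ℝ) - ratio n q (p + 1) h) := by
  have h1 : (Fintype.card (Hook q p h) : ℝ) ≠ 0 := by exact_mod_cast (card_hook_pos hp h).ne'
  rw [relDim, Nat.cast_sub ((ratio_le_iff hp hqn h).1 hd), ratio_eq_card hp hqn,
    ← card_hook q p h (by omega), Int.cast_natCast, Nat.cast_mul]
  field_simp

theorem relDim_eq_zero (hp : p + 1 ≤ q) (hqn : q < n) {h : ℕ}
    (hd : (d : ℝ) < ratio n q (p + 1) h) : relDim n d q p h = 0 := by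
  have h1 := mt (ratio_le_iff hp hqn h).2 hd.not_ge
  unfold relDim
  omega

theorem relDim_eq_piTerm (hp : p + 1 ≤ q) (hqn : q < n) (h : ℕ) :
    (relDim n d q p h : ℝ) = piTerm n d q (p + 1) h := by
  rcases le_or_gt (ratio n q (p + 1) h) d with hd | hd
  · rw [relDim_eq hp hqn hd, piTerm, max_eq_left (sub_nonneg.2 hd)]
  · rw [relDim_eq_zero hp hqn hd, piTerm, max_eq_right (sub_nonpos.2 hd.le)]
    simp

end

end Web

end

theorem mainTheorem2 (n d q p : ℕ) (hp : 1 ≤ p) (hpq : p ≤ q) (hqn : q < n)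
    (U : Set (Web.Amb n)) (hU : IsOpen U)
    (F : Fin d → Web.Foliation n q U)
    (hord : Web.StronglyOrdinary q p U (fun i => (F i).T))
    (hd : Web.ratio n q p 0 < (d : ℝ)) :
    IsGreatest {h : ℕ | Web.ratio n q p h ≤ (d : ℝ)} (Web.kOne n d q p) ∧
    (∀ k ≤ Web.kOne n d q p, ∃ r : ℕ,
      (r : ℝ) = ∑ h ∈ Finset.range (k + 1),
        (Web.z q p h : ℝ) * ((d : ℝ) - Web.ratio n q p h) ∧
      Web.IsHolomorphicSubbundle (V := Fin d → Web.Jet n p k) U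
        (Web.formalRel p k (fun i => (F i).T)) r) ∧
    (Function.support (Web.piTerm n d q p)).Finite ∧
    ∃ r : ℕ, Web.closedRank p U (fun i => (F i).T) = r ∧ (r : ℝ) ≤ Web.piPrime n d q p := by
  have hmax := Web.isGreatest_kOne hp hpq hqn hd
  have hmono := (Web.ratio_strictMono hp hpq hqn).monotone
  obtain ⟨p, rfl⟩ := Nat.exists_eq_add_of_le' hp
  have hle : ∀ h ≤ Web.kOne n d q (p + 1), Web.ratio n q (p + 1) h ≤ (d : ℝ) := fun h hh =>
    (hmono hh).trans hmax.1
  have hzero : ∀ h, Web.kOne n d q (p + 1) + 1 ≤ h → Web.relDim n d q p h = 0 := fun h hh =>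
    Web.relDim_eq_zero hpq hqn (not_le.1 fun hr => by have := hmax.2 hr; omega)
  have hpi : ∀ h ∉ Finset.range (Web.kOne n d q (p + 1) + 1), Web.piTerm n d q (p + 1) h = 0 :=
    fun h hh => by
      rw [← Web.relDim_eq_piTerm hpq hqn, hzero h (by simpa using hh), Nat.cast_zero]
  refine ⟨hmax, fun k hk => ⟨_, ?_, Web.isHolomorphicSubbundle_formalRel (by omega) (by omega) hU F
    hord fun h hh => (Web.ratio_le_iff hpq hqn h).1 (hle h (hh.trans hk))⟩, ?_, ?_⟩
  · rw [Nat.cast_sum]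
    exact Finset.sum_congr rfl fun h hh => Web.relDim_eq hpq hqn
      (hle h ((Nat.lt_succ_iff.1 (Finset.mem_range.1 hh)).trans hk))
  · exact (Finset.range (Web.kOne n d q (p + 1) + 1)).finite_toSet.subset fun h hh =>
      by_contra fun hh' => hh (hpi h hh')
  · have hbound : Web.closedRank (p + 1) U (fun i => (F i).T) ≤
        (∑ h ∈ Finset.range (Web.kOne n d q (p + 1) + 1), Web.relDim n d q p h : ℕ) := by
      refine iSup₂_le fun m hm => ?_
      choose W _ hmW _ u hu using fun i => (F i).exists_isLocalSubmersion hm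
      exact Web.finrank_germRel_le (by omega) (by omega) (fun i => hu i m (hmW i)) (hord m hm) hzero
    obtain ⟨r, hr, hr'⟩ := ENat.le_natCast_iff.1 hbound
    refine ⟨r, hr, ?_⟩
    rw [Web.piPrime, tsum_eq_sum hpi]
    simp only [← Web.relDim_eq_piTerm hpq hqn]
    exact_mod_cast hr'
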